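/- Let $n\ge 1$ and let $F$ be a set of $n$ white ($\circ$) and $n$ black ($\bullet$) points in the plane in general position (no three on a line). A *BR-matching* of $F$ is a set of $n$ pairwise non-crossing straight segments, each joining a white point to a black point of $F$, such that each point of $F$ is an end of exactly one segment. Every segment $A$ is directed from its white to its black end; $g(A)$ is the line containing $A$, directed like $A$. Removing the inner points of $A$ from $g(A)$ leaves two closed *outer rays*, the white ray (starting at the white end) and the black ray (starting at the black end). Two segments are *parallel* (*antiparallel*) if their supporting lines do not cross and their directions agree (are opposite). Let $M$ be a BR-matching of $F$. Then the following conditions are equivalent. 1. $M$ is the only BR-matching of $F$. 2. $M$ is a *linear matching*: $M$ has no chromatic cut, that is, no line crosses two segments of $M$ whose black ends are on different sides of the line; and the circular sequence of the points of $F$ on the boundary of the convex hull of $F$ consists of exactly two color intervals (maximal runs of consecutive points of the same color). 3. The relation $\triangleleft$ is a strict linear order on $M$, where $A\triangleleft B$ means that $B$ lies strictly to the right of $g(A)$ and $A$ lies strictly to the left of $g(B)$. 4. $M$ contains none of the following three patterns: (a) two different segments such that an outer ray of one crosses the other segment; (b) two different segments such that an outer ray of one crosses the outer ray of the other color of the other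 segment, or that are antiparallel; (c) a *3-star*: three segments such that outer rays of one common color cross pairwise and such that the supporting line of each of the segments separates the other two segments (the three supporting lines may be concurrent). 5. $M$ is *quasi-parallel*: there is a directed line $\ell$ such that (i) no segment of $M$ is perpendicular to $\ell$; (ii) for every $A\in M$ the projection of $A$ on $\ell$ is directed like $\ell$; (iii) for all non-parallel $A,B\in M$, the projection on $\ell$ of the intersection point of $g(A)$ and $g(B)$, if the lines meet, lies outside the convex hull of the projections of $A$ and $B$ on $\ell$. -/

import Mathlib

/-- The Euclidean plane. -/
abbrev Plane : Type := EuclideanSpace ℝ (Fin 2)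

/-- A directed segment: its white end (the tail) and its black end (the head). -/
abbrev DirSeg : Type := Plane × Plane

/-- `0 < turn p q x` iff `x` is strictly to the left of the line through `p` and `q` directed from
`p` to `q`; `turn p q x < 0` iff it is strictly to the right (for `p ≠ q`). -/
noncomputable def turn (p q x : Plane) : ℝ :=
  (q 0 - p 0) * (x 1 - p 1) - (q 1 - p 1) * (x 0 - p 0)

/-- The point `x` lies strictly left of the directed line `pq`. -/
def PtLeft (p q x : Plane) : Prop := 0 < turn p q x

/-- The point `x` lies strictly right of the directed line `pq`. -/
def PtRight (p q x : Plane) : Prop := turn p q x < 0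

/-- `W` (white points) and `B` (black points) form a bichromatic `(n+n)` point set in general
position: no three points on a line. -/
structure IsBichromatic (n : ℕ) (W B : Finset Plane) : Prop where
  disj : Disjoint W B
  card_white : W.card = n
  card_black : B.card = n
  general_position : ∀ p ∈ (W ∪ B : Set Plane), ∀ q ∈ (W ∪ B : Set Plane),
    ∀ r ∈ (W ∪ B : Set Plane), p ≠ q → p ≠ r → q ≠ r → ¬ Collinear ℝ {p, q, r}

namespace DirSeg

/-- The direction vector, from the white to the black end. -/
noncomputable def dir (A : DirSeg) : Plane := A.2 - A.1

/-- The set of points of the closed segment. -/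
def carrier (A : DirSeg) : Set Plane := segment ℝ A.1 A.2

/-- The supporting line `g(A)`. -/
noncomputable def line (A : DirSeg) : AffineSubspace ℝ Plane := affineSpan ℝ {A.1, A.2}

/-- The closed outer ray starting at the white end. -/
def whiteRay (A : DirSeg) : Set Plane := {x | ∃ t : ℝ, 0 ≤ t ∧ x = A.1 - t • A.dir}

/-- The closed outer ray starting at the black end. -/
def blackRay (A : DirSeg) : Set Plane := {x | ∃ t : ℝ, 0 ≤ t ∧ x = A.2 + t • A.dir}

/-- `A` and `B` are parallel, with the same orientation. -/
def Parallel (A B : DirSeg) : Prop := SameRay ℝ A.dir B.dir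

/-- `A` and `B` are parallel as undirected segments, with opposite orientations. -/
def Antiparallel (A B : DirSeg) : Prop := SameRay ℝ A.dir (-B.dir)

/-- The segment `X` lies strictly left of the directed line `g(A)`. -/
def LiesLeft (A X : DirSeg) : Prop := PtLeft A.1 A.2 X.1 ∧ PtLeft A.1 A.2 X.2

/-- The segment `X` lies strictly right of the directed line `g(A)`. -/
def LiesRight (A X : DirSeg) : Prop := PtRight A.1 A.2 X.1 ∧ PtRight A.1 A.2 X.2

/-- The sidedness relation `A ◁ B`. -/
def Sided (A B : DirSeg) : Prop := LiesRight A B ∧ LiesLeft B A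

/-- The segments `Y` and `Z` lie strictly on different sides of the line `g(X)`. -/
def Separates (X Y Z : DirSeg) : Prop :=
  (LiesLeft X Y ∧ LiesRight X Z) ∨ (LiesRight X Y ∧ LiesLeft X Z)

/-- First forbidden pattern: an outer ray of `A` crosses the other segment `B`. -/
def RayHitsSegment (A B : DirSeg) : Prop :=
  A ≠ B ∧ ((whiteRay A ∪ blackRay A) ∩ carrier B).Nonempty

/-- Second forbidden pattern: outer rays of different colors cross; antiparallel segments are
the special case in which the crossing is at infinity. -/
def OppositeRaysMeet (A B : DirSeg) : Prop :=
  A ≠ B ∧ ((whiteRay A ∩ blackRay B).Nonempty ∨ Antiparallel A B)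

/-- Third forbidden pattern, the 3-star: outer rays of one common color cross pairwise, and the
supporting line of each segment separates the other two (the three supporting lines may be
concurrent). -/
def ThreeStar (A B C : DirSeg) : Prop :=
  (((whiteRay A ∩ whiteRay B).Nonempty ∧ (whiteRay B ∩ whiteRay C).Nonempty ∧
      (whiteRay A ∩ whiteRay C).Nonempty) ∨
    ((blackRay A ∩ blackRay B).Nonempty ∧ (blackRay B ∩ blackRay C).Nonempty ∧
      (blackRay A ∩ blackRay C).Nonempty)) ∧
  Separates A B C ∧ Separates B A C ∧ Separates C A B

/-- The line through `p` and `q` crosses the segment `A`: the ends of `A` are strictly on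
different sides of it. -/
def CrossedBy (A : DirSeg) (p q : Plane) : Prop :=
  (PtLeft p q A.1 ∧ PtRight p q A.2) ∨ (PtRight p q A.1 ∧ PtLeft p q A.2)

end DirSeg

/-- `M` is a perfect non-crossing straight-line matching of the white points `W` with the black
points `B`. Segments of a perfect matching share no end, so non-crossing means disjoint. -/
structure IsBRMatching (W B : Finset Plane) (M : Finset DirSeg) : Prop where
  ends : ∀ A ∈ M, A.1 ∈ W ∧ A.2 ∈ B
  white : ∀ w ∈ W, ∃! A : DirSeg, A ∈ M ∧ A.1 = w
  black : ∀ b ∈ B, ∃! A : DirSeg, A ∈ M ∧ A.2 = b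
  noncrossing : ∀ A ∈ M, ∀ A' ∈ M, A ≠ A' → Disjoint (DirSeg.carrier A) (DirSeg.carrier A')

/-- The line through `p ≠ q` is a chromatic cut of `M`: it crosses two segments of `M` whose black
ends are on different sides of it. -/
def IsChromaticCut (M : Finset DirSeg) (p q : Plane) : Prop :=
  p ≠ q ∧ ∃ A ∈ M, ∃ A' ∈ M, A.CrossedBy p q ∧ A'.CrossedBy p q ∧
    PtLeft p q A.2 ∧ PtRight p q A'.2

/-- The boundary of the convex hull of the point set. -/
def hullBoundary (W B : Finset Plane) : Set Plane :=
  frontier (convexHull ℝ (W ∪ B : Set Plane))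

/-- The points of the point set that lie on the boundary of its convex hull. -/
abbrev BoundaryPoint (W B : Finset Plane) : Type :=
  {p : Plane // p ∈ (W ∪ B : Set Plane) ∧ p ∈ hullBoundary W B}

/-- Two boundary points are joined if they are consecutive in the circular sequence along the
boundary of the convex hull (the segment between them lies in the boundary) and have the same
color. -/
def sameColorGraph (W B : Finset Plane) : SimpleGraph (BoundaryPoint W B) where
  Adj p q := p ≠ q ∧ segment ℝ p.1 q.1 ⊆ hullBoundary W B ∧ (p.1 ∈ W ↔ q.1 ∈ W)
  symm := ⟨fun p q h => ⟨h.1.symm, by rw [segment_symm]; exact h.2.1, h.2.2.symm⟩⟩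
  loopless := ⟨fun _ h => h.1 rfl⟩

/-- A color interval: a maximal run of consecutive boundary points of one color. -/
abbrev ColorInterval (W B : Finset Plane) : Type := (sameColorGraph W B).ConnectedComponent

/-- `M` is linear: it has no chromatic cut, and the boundary of the convex hull has exactly two
color intervals. -/
def IsLinearMatching (W B : Finset Plane) (M : Finset DirSeg) : Prop :=
  (¬ ∃ p q : Plane, IsChromaticCut M p q) ∧ Nat.card (ColorInterval W B) = 2

/-- `M` contains none of the three forbidden patterns. -/
def AvoidsPatterns (M : Finset DirSeg) : Prop :=
  (∀ A ∈ M, ∀ B ∈ M, ¬ DirSeg.RayHitsSegment A B) ∧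
  (∀ A ∈ M, ∀ B ∈ M, ¬ DirSeg.OppositeRaysMeet A B) ∧
  (∀ A ∈ M, ∀ B ∈ M, ∀ C ∈ M, ¬ DirSeg.ThreeStar A B C)

/-- `M` is quasi-parallel. Only the direction `u` of the directed reference line matters, and the
projection of `x` on that line is recorded by its coordinate `⟪u, x⟫`. -/
def IsQuasiParallel (M : Finset DirSeg) : Prop :=
  ∃ u : Plane, u ≠ 0 ∧
    (∀ A ∈ M, inner ℝ u A.dir ≠ 0) ∧
    (∀ A ∈ M, 0 < inner ℝ u A.dir) ∧
    (∀ A ∈ M, ∀ B ∈ M, ¬ DirSeg.Parallel A B → ∀ x : Plane, x ∈ A.line → x ∈ B.line →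
      inner ℝ u x ∉ convexHull ℝ ((fun y : Plane => inner ℝ u y) '' (A.carrier ∪ B.carrier)))

/-!
For comparable segments `A ◁ B` the four ends are in convex position, in the order white, black,
black, white, so the segments between ends of different segments and different colors cross. Hence
no line crosses `A` and `B` with their black ends on different sides
(`DirSeg.Sided.not_cut`). For two segments that are not comparable such a line exists
(`DirSeg.Generic.exists_cut`). So the absence of chromatic cuts, the absence of the first two
patterns, and the comparability of any two segments (`PairwiseSided`) are the same condition.
Under this condition, `◁` is a linear order unless it has a cycle of length three.

Let `f_A`, `f_B`, `f_C` be the equations of the lines of three segments. The cross products of the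
directions, taken as coefficients, annihilate the directions, so the corresponding combination of
the equations is constant. Comparing its values at the segments shows that the
directions of a cycle turn consistently (`DirSeg.cycle_signs`), so that a cycle is a 3-star, and
that no segment is to the left of all segments of a cycle (`DirSeg.not_source_of_cycle`). The same
idea for a linearly ordered matching shows that its directions lie in an open half-plane
(`exists_inner_dir_pos`). This is all of quasi-parallelism, since the lines of comparable
segments meet on outer rays of one color. Conversely, a direction with positive projections excludes
cycles, since directions that turn consistently positively span the plane.

Uniqueness implies linearity. If two segments are not comparable, take a chromatic cut, and among
all ways to join white points to black points minimize the number of crossings with the cut plus a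
small multiple of the total length. Uncrossing lowers this cost, so a minimizer is a matching, and
it is not `M`, because exchanging two black ends makes `M` cheaper (`pairwiseSided_of_unique`).
If all segments are comparable and there is a cycle, then the segments to the right of any
given segment are linearly ordered, and joining every white end to the black end of the
immediate successor is another matching (`noSidedCycle_of_unique`).

Linearity implies uniqueness. Measure heights along the common direction. Any segment of another
matching `M'` crosses the lines of the segments of `M` between those of its ends, and disjoint
segments cross all these lines in the same order (`AboveAt.transfer` in the proof of
`eq_of_isStrictTotalOrder`). So "above" has a topmost element among the segments of `M'` outside `M`
(`exists_top`). However, such a segment with white end `w` always has above it the segment of `M'`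
that ends in the partner of `w` in `M`.

For the convex hull, boundary points are those at which a nonzero linear functional attains its
maximum, and two of them are joined by hull edges on one side of the line through them
(`exists_hullChain`). In a linearly ordered matching the chain below two white boundary points is
white, and the chain above two black ones is black, so there are two color intervals
(`card_colorInterval`). Conversely, two color intervals force a hull edge with ends of different
colors. It belongs to the matching and has all other segments on one side, which excludes cycles
(`noSidedCycle_of_isLinearMatching`).
-/

/-! ### Oriented areas -/

/-- The two-dimensional cross product; `wedge a b > 0` iff `b` points to the left of `a`. -/
noncomputable def wedge (a b : Plane) : ℝ := a 0 * b 1 - a 1 * b 0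

theorem turn_rotate (p q r : Plane) : turn p q r = turn q r p := by
  unfold turn; ring

theorem turn_swap (p q r : Plane) : turn q p r = -turn p q r := by
  unfold turn; ring

theorem turn_swap_right (p q r : Plane) : turn p r q = -turn p q r := by
  unfold turn; ring

@[simp] theorem turn_self (p r : Plane) : turn p p r = 0 := by
  unfold turn; ring

@[simp] theorem turn_left (p q : Plane) : turn p q p = 0 := by
  unfold turn; ring

@[simp] theorem turn_right (p q : Plane) : turn p q q = 0 := by
  unfold turn; ring

theorem turn_combo (p q x y : Plane) {a b : ℝ} (h : a + b = 1) :
    turn p q (a • x + b • y) = a * turn p q x + b * turn p q y := by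
  obtain rfl : b = 1 - a := by linarith
  simp only [turn, PiLp.add_apply, PiLp.smul_apply, smul_eq_mul]
  ring

theorem turn_add_smul (p q x v : Plane) (t : ℝ) :
    turn p q (x + t • v) = turn p q x + t * wedge (q - p) v := by
  simp only [turn, wedge, PiLp.add_apply, PiLp.smul_apply, PiLp.sub_apply, smul_eq_mul]
  ring

theorem turn_sub_turn (p q x y : Plane) : turn p q y - turn p q x = wedge (q - p) (y - x) := by
  simp only [turn, wedge, PiLp.sub_apply]
  ring

theorem wedge_swap (a b : Plane) : wedge b a = -wedge a b := by
  unfold wedge; ring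

theorem plane_ext {x y : Plane} (h0 : x 0 = y 0) (h1 : x 1 = y 1) : x = y := by
  ext i; fin_cases i
  · exact h0
  · exact h1

/-- Two segments meet as soon as the ends of each lie weakly on different sides of the line
through the other and the two lines are not parallel. Some ends may lie on the lines. -/
theorem segments_meet {p q r s : Plane} (h1 : turn p q r * turn p q s ≤ 0)
    (h2 : turn r s p * turn r s q ≤ 0) (hne : turn p q r ≠ turn p q s) :
    ∃ x, x ∈ segment ℝ p q ∧ x ∈ segment ℝ r s := by
  have key : turn r s q - turn r s p = -(turn p q s - turn p q r) := by unfold turn; ring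
  set α := turn p q r with hα
  set β := turn p q s with hβ
  set γ := turn r s p with hγ
  set δ := turn r s q with hδ
  have hβα : β - α ≠ 0 := sub_ne_zero.2 (Ne.symm hne)
  have hδγ : δ - γ ≠ 0 := by rw [key]; exact neg_ne_zero.2 hβα
  -- A quotient of the form `y / (y - x)` is nonnegative when `x * y ≤ 0`.
  have quot : ∀ x y : ℝ, x * y ≤ 0 → y - x ≠ 0 → 0 ≤ y / (y - x) ∧ 0 ≤ -x / (y - x) := by
    intro x y hxy hne
    have e1 : y / (y - x) = (y * (y - x)) / (y - x) ^ 2 := by field_simp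
    have e2 : -x / (y - x) = (-x * (y - x)) / (y - x) ^ 2 := by field_simp
    rw [e1, e2]
    constructor <;> apply div_nonneg <;> nlinarith [sq_nonneg x, sq_nonneg y, sq_nonneg (y - x)]
  obtain ⟨a1, a2⟩ := quot γ δ h2 hδγ
  obtain ⟨b1, b2⟩ := quot α β h1 hβα
  refine ⟨(δ / (δ - γ)) • p + (-γ / (δ - γ)) • q, ⟨_, _, a1, a2, by field_simp; ring, rfl⟩,
    ⟨β / (β - α), -α / (β - α), b1, b2, by field_simp; ring, ?_⟩⟩
  have e1 : δ - γ = -(β - α) := key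
  rw [e1]
  apply plane_ext <;>
  · simp only [PiLp.add_apply, PiLp.smul_apply, smul_eq_mul]
    field_simp
    simp only [hα, hβ, hγ, hδ, turn]
    ring

/-- The relation between three vectors of the plane, weighted by their cross products. -/
theorem wedge_relation (a b c : Plane) (i : Fin 2) :
    wedge b c * a i + wedge c a * b i + wedge a b * c i = 0 := by
  fin_cases i <;> simp [wedge] <;> ring

theorem segment_combo {p q x : Plane} (hx : x ∈ segment ℝ p q) :
    ∃ t : ℝ, 0 ≤ t ∧ t ≤ 1 ∧ x = p + t • (q - p) := by
  obtain ⟨a, b, ha, hb, hab, rfl⟩ := hx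
  refine ⟨b, hb, by linarith, ?_⟩
  obtain rfl : a = 1 - b := by linarith
  module

theorem turn_neg_of_mem_segment {p q r s x : Plane} (hx : x ∈ segment ℝ r s)
    (hr : turn p q r < 0) (hs : turn p q s < 0) : turn p q x < 0 := by
  obtain ⟨a, b, ha, hb, hab, rfl⟩ := hx
  rw [turn_combo _ _ _ _ hab]
  rcases ha.eq_or_lt with rfl | ha'
  · obtain rfl : b = 1 := by linarith
    linarith
  · nlinarith

theorem turn_pos_of_mem_segment {p q r s x : Plane} (hx : x ∈ segment ℝ r s)
    (hr : 0 < turn p q r) (hs : 0 < turn p q s) : 0 < turn p q x := by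
  have := turn_neg_of_mem_segment (p := q) (q := p) hx (by rw [turn_swap]; linarith)
    (by rw [turn_swap]; linarith)
  rw [turn_swap] at this; linarith

/-- Vanishing oriented area is collinearity. -/
theorem collinear_of_turn_eq_zero {p q r : Plane} (h : turn p q r = 0) :
    Collinear ℝ {p, q, r} := by
  by_cases hpq : p = q
  · subst hpq
    simpa using collinear_pair ℝ p r
  rw [collinear_iff_of_mem (p₀ := p) (by simp)]
  refine ⟨q - p, ?_⟩
  have hr : ∃ t : ℝ, r = t • (q - p) + p := by
    by_cases h0 : q 0 - p 0 = 0
    · have h1 : q 1 - p 1 ≠ 0 := fun h1 => hpq (plane_ext (by linarith) (by linarith))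
      have h2 : r 0 - p 0 = 0 := by
        have : (q 1 - p 1) * (r 0 - p 0) = 0 := by unfold turn at h; rw [h0] at h; linarith
        exact (mul_eq_zero.1 this).resolve_left h1
      refine ⟨(r 1 - p 1) / (q 1 - p 1), plane_ext ?_ ?_⟩ <;>
        simp only [PiLp.add_apply, PiLp.smul_apply, PiLp.sub_apply, smul_eq_mul]
      · rw [h0]; linarith
      · field_simp; ring
    · refine ⟨(r 0 - p 0) / (q 0 - p 0), plane_ext ?_ ?_⟩ <;>
        simp only [PiLp.add_apply, PiLp.smul_apply, PiLp.sub_apply, smul_eq_mul]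
      · field_simp; ring
      · unfold turn at h
        field_simp
        linarith
  obtain ⟨t, ht⟩ := hr
  intro x hx
  simp only [Set.mem_insert_iff, Set.mem_singleton_iff] at hx
  rcases hx with rfl | rfl | rfl
  · exact ⟨0, by simp⟩
  · exact ⟨1, by simp⟩
  · exact ⟨t, by simpa using ht⟩

/-! ### Pairs of segments -/

namespace DirSeg

theorem sided_iff {A B : DirSeg} : Sided A B ↔
    (turn A.1 A.2 B.1 < 0 ∧ turn A.1 A.2 B.2 < 0) ∧
      (0 < turn B.1 B.2 A.1 ∧ 0 < turn B.1 B.2 A.2) := Iff.rfl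

theorem Sided.asymm {A B : DirSeg} (h : Sided A B) : ¬ Sided B A := fun h' =>
  lt_asymm h.1.1 h'.2.1

theorem Sided.ne {A B : DirSeg} (h : Sided A B) : A ≠ B := by
  rintro rfl; exact h.asymm h

/-- Reversing all segments reverses the sidedness relation. -/
theorem Sided.swap {A B : DirSeg} (h : Sided A B) : Sided (Prod.swap B) (Prod.swap A) := by
  rw [sided_iff] at h ⊢
  simp only [Prod.fst_swap, Prod.snd_swap, turn_swap A.1, turn_swap B.1]
  refine ⟨⟨?_, ?_⟩, ?_, ?_⟩ <;> linarith

/-- The ends of comparable segments are in convex position, in the order white, black, black,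
white. -/
theorem Sided.diagonals_meet {A B : DirSeg} (h : Sided A B) :
    ∃ x, x ∈ segment ℝ A.1 B.2 ∧ x ∈ segment ℝ B.1 A.2 := by
  obtain ⟨⟨h1, h2⟩, h3, h4⟩ := h
  unfold PtRight at h1 h2
  unfold PtLeft at h3 h4
  have e1 : turn A.1 B.2 B.1 = -turn B.1 B.2 A.1 := by unfold turn; ring
  have e2 : turn A.1 B.2 A.2 = -turn A.1 A.2 B.2 := by unfold turn; ring
  have e3 : turn B.1 A.2 A.1 = -turn A.1 A.2 B.1 := by unfold turn; ring
  have e4 : turn B.1 A.2 B.2 = -turn B.1 B.2 A.2 := by unfold turn; ring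
  apply segments_meet
  · rw [e1, e2]; nlinarith
  · rw [e3, e4]; nlinarith
  · rw [e1, e2]; intro h; linarith

theorem Sided.not_cut {A B : DirSeg} (h : Sided A B) (p q : Plane)
    (hA : A.CrossedBy p q) (hB : B.CrossedBy p q) :
    ¬ (turn p q A.2 * turn p q B.2 < 0) := by
  intro hneg
  obtain ⟨x, hx1, hx2⟩ := h.diagonals_meet
  unfold CrossedBy PtLeft PtRight at hA hB
  rcases hA with ⟨a1, a2⟩ | ⟨a1, a2⟩ <;> rcases hB with ⟨b1, b2⟩ | ⟨b1, b2⟩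
  · nlinarith
  · exact lt_asymm (turn_pos_of_mem_segment hx1 a1 b2) (turn_neg_of_mem_segment hx2 b1 a2)
  · exact lt_asymm (turn_pos_of_mem_segment hx2 b1 a2) (turn_neg_of_mem_segment hx1 a1 b2)
  · nlinarith

/-- Two segments in general position: no end of one lies on the supporting line of the other,
and they do not cross. -/
structure Generic (A B : DirSeg) : Prop where
  left₁ : turn A.1 A.2 B.1 ≠ 0
  left₂ : turn A.1 A.2 B.2 ≠ 0
  right₁ : turn B.1 B.2 A.1 ≠ 0
  right₂ : turn B.1 B.2 A.2 ≠ 0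
  disj : Disjoint (carrier A) (carrier B)

theorem Generic.symm {A B : DirSeg} (h : Generic A B) : Generic B A :=
  ⟨h.right₁, h.right₂, h.left₁, h.left₂, h.disj.symm⟩

theorem turn_sub_eq_wedge (A B : DirSeg) :
    turn A.1 A.2 B.2 - turn A.1 A.2 B.1 = wedge A.dir B.dir := turn_sub_turn _ _ _ _

/-- If the line `g(A)` crosses `B`, then `g(B)` does not cross `A`. -/
theorem Generic.same_side {A B : DirSeg} (h : Generic A B)
    (hA : turn A.1 A.2 B.1 * turn A.1 A.2 B.2 < 0) :
    0 < turn B.1 B.2 A.1 * turn B.1 B.2 A.2 := by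
  by_contra hB
  obtain ⟨x, hx1, hx2⟩ := segments_meet (p := A.1) (q := A.2) (r := B.1) (s := B.2) hA.le
    (not_lt.1 hB) (fun h' => by rw [h'] at hA; nlinarith [mul_self_nonneg (turn A.1 A.2 B.2)])
  exact Set.disjoint_left.1 h.disj hx1 hx2

/-- If `A` is on one side of `g(B)` and some end of `B` lies on the side of the same name of `g(A)`,
then a line through the midpoint of `A` and a suitable inner
point of `B` crosses both segments with the black ends on different sides. -/
theorem exists_cut_aux {A B : DirSeg} (hβ : 0 < turn B.1 B.2 A.1 * turn B.1 B.2 A.2)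
    (hα : 0 < turn A.1 A.2 B.1 * turn B.1 B.2 A.1 ∨
      0 < turn A.1 A.2 B.2 * turn B.1 B.2 A.1) :
    ∃ p q, turn p q A.1 * turn p q A.2 < 0 ∧ turn p q B.1 * turn p q B.2 < 0 ∧
      turn p q A.2 * turn p q B.2 < 0 := by
  set α₁ := turn A.1 A.2 B.1 with h1
  set α₂ := turn A.1 A.2 B.2 with h2
  set β₁ := turn B.1 B.2 A.1 with h3
  set β₂ := turn B.1 B.2 A.2 with h4
  obtain ⟨s, hs0, hs1, hs⟩ : ∃ s : ℝ, 0 < s ∧ s < 1 ∧ 0 < ((1 - s) * α₁ + s * α₂) * β₁ := by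
    -- For `u > 0`, a combination of `u` and `v` with most of its weight on `u` is positive.
    have aux : ∀ u v : ℝ, 0 < u → ∃ s : ℝ, 0 < s ∧ s < 1 ∧ 0 < (1 - s) * u + s * v := by
      intro u v hu
      have hv := neg_abs_le v
      have habs := abs_nonneg v
      have hpos : 0 < 2 * (u + |v|) := by linarith
      refine ⟨u / (2 * (u + |v|)), by positivity, by rw [div_lt_one hpos]; linarith, ?_⟩
      have : (1 - u / (2 * (u + |v|))) * u + u / (2 * (u + |v|)) * v =
          (u * (u + 2 * |v| + v)) / (2 * (u + |v|)) := by field_simp; ring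
      rw [this]
      apply div_pos (mul_pos hu (by linarith)) hpos
    rcases hα with h | h
    · obtain ⟨s, a, b, c⟩ := aux _ (α₂ * β₁) h
      exact ⟨s, a, b, by linarith⟩
    · obtain ⟨s, a, b, c⟩ := aux _ (α₁ * β₁) h
      exact ⟨1 - s, by linarith, by linarith, by linarith⟩
  have hx : turn A.1 A.2 ((1 - s) • B.1 + s • B.2) = (1 - s) * α₁ + s * α₂ :=
    turn_combo _ _ _ _ (by ring)
  set σ := (1 - s) * α₁ + s * α₂ with hσ
  refine ⟨(1 / 2 : ℝ) • A.1 + (1 / 2 : ℝ) • A.2, (1 - s) • B.1 + s • B.2, ?_⟩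
  have e1 : turn ((1 / 2 : ℝ) • A.1 + (1 / 2 : ℝ) • A.2) ((1 - s) • B.1 + s • B.2) A.1 = σ / 2 := by
    rw [hσ, h1, h2]
    simp only [turn, PiLp.add_apply, PiLp.smul_apply, smul_eq_mul]; ring
  have e2 : turn ((1 / 2 : ℝ) • A.1 + (1 / 2 : ℝ) • A.2) ((1 - s) • B.1 + s • B.2) A.2 = -σ / 2 := by
    rw [hσ, h1, h2]
    simp only [turn, PiLp.add_apply, PiLp.smul_apply, smul_eq_mul]; ring
  have e3 : turn ((1 / 2 : ℝ) • A.1 + (1 / 2 : ℝ) • A.2) ((1 - s) • B.1 + s • B.2) B.1 =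
      -s * ((β₁ + β₂) / 2) := by
    rw [h3, h4]
    simp only [turn, PiLp.add_apply, PiLp.smul_apply, smul_eq_mul]; ring
  have e4 : turn ((1 / 2 : ℝ) • A.1 + (1 / 2 : ℝ) • A.2) ((1 - s) • B.1 + s • B.2) B.2 =
      (1 - s) * ((β₁ + β₂) / 2) := by
    rw [h3, h4]
    simp only [turn, PiLp.add_apply, PiLp.smul_apply, smul_eq_mul]; ring
  have hσ0 : 0 < σ ^ 2 := by
    have : σ ≠ 0 := by rintro h; rw [h] at hs; simp at hs
    positivity
  have hβ0 : 0 < (β₁ + β₂) ^ 2 := by nlinarith [sq_nonneg β₁, sq_nonneg β₂]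
  have hss : 0 < s * (1 - s) := mul_pos hs0 (by linarith)
  have hσβ : 0 < σ * (β₁ + β₂) := by
    have : 0 < (σ * β₁) * (β₁ * (β₁ + β₂)) := mul_pos hs (by nlinarith [sq_nonneg β₁])
    have h5 : 0 < β₁ ^ 2 * (σ * (β₁ + β₂)) := by linarith
    exact pos_of_mul_pos_right h5 (sq_nonneg _)
  rw [e1, e2, e3, e4]
  refine ⟨by nlinarith, ?_, ?_⟩
  · nlinarith [mul_pos hss hβ0]
  · nlinarith [mul_pos (sub_pos.2 hs1) hσβ]

theorem crossedBy_of_mul_neg {A : DirSeg} {p q : Plane} (h : turn p q A.1 * turn p q A.2 < 0) :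
    A.CrossedBy p q := by
  rcases mul_neg_iff.1 h with h | h
  · exact Or.inl h
  · exact Or.inr h

/-- Segments in general position that are not comparable have a chromatic cut. -/
theorem Generic.exists_cut {A B : DirSeg} (h : Generic A B) (hAB : ¬ Sided A B)
    (hBA : ¬ Sided B A) :
    ∃ p q, A.CrossedBy p q ∧ B.CrossedBy p q ∧ turn p q A.2 * turn p q B.2 < 0 := by
  suffices H : ∃ p q, turn p q A.1 * turn p q A.2 < 0 ∧ turn p q B.1 * turn p q B.2 < 0 ∧
      turn p q A.2 * turn p q B.2 < 0 by
    obtain ⟨p, q, h1, h2, h3⟩ := H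
    exact ⟨p, q, crossedBy_of_mul_neg h1, crossedBy_of_mul_neg h2, h3⟩
  rcases lt_or_gt_of_ne (mul_ne_zero h.right₁ h.right₂) with hβ | hβ
  · have hα := h.symm.same_side hβ
    have : ∃ p q, turn p q B.1 * turn p q B.2 < 0 ∧ turn p q A.1 * turn p q A.2 < 0 ∧
        turn p q B.2 * turn p q A.2 < 0 := by
      apply exists_cut_aux hα
      by_contra hcon
      push Not at hcon
      obtain ⟨c1, c2⟩ := hcon
      have h0 : 0 < turn A.1 A.2 B.1 ^ 2 := by have := h.left₁; positivity
      nlinarith [mul_nonneg_of_nonpos_of_nonpos c1 c2, mul_neg_of_pos_of_neg h0 hβ]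
    obtain ⟨p, q, h1, h2, h3⟩ := this
    exact ⟨p, q, h2, h1, by linarith⟩
  · apply exists_cut_aux hβ
    by_contra hcon
    push Not at hcon
    obtain ⟨c1, c2⟩ := hcon
    rcases lt_or_gt_of_ne h.right₁ with h3 | h3
    · have h4 : turn B.1 B.2 A.2 < 0 := by nlinarith
      have h1 : 0 < turn A.1 A.2 B.1 := lt_of_le_of_ne (by nlinarith) h.left₁.symm
      have h2 : 0 < turn A.1 A.2 B.2 := lt_of_le_of_ne (by nlinarith) h.left₂.symm
      exact hBA ⟨⟨h3, h4⟩, h1, h2⟩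
    · have h4 : 0 < turn B.1 B.2 A.2 := by nlinarith
      have h1 : turn A.1 A.2 B.1 < 0 := lt_of_le_of_ne (by nlinarith) h.left₁
      have h2 : turn A.1 A.2 B.2 < 0 := lt_of_le_of_ne (by nlinarith) h.left₂
      exact hAB ⟨⟨h1, h2⟩, h3, h4⟩

end DirSeg

/-! ### Outer rays -/

namespace DirSeg

theorem add_smul_dir_mem_carrier (A : DirSeg) {s : ℝ} (h0 : 0 ≤ s) (h1 : s ≤ 1) :
    A.1 + s • A.dir ∈ A.carrier :=
  ⟨1 - s, s, by linarith, h0, by ring, by simp only [dir]; module⟩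

theorem add_smul_dir_mem_whiteRay (A : DirSeg) {s : ℝ} (h : s ≤ 0) :
    A.1 + s • A.dir ∈ A.whiteRay := ⟨-s, by linarith, by module⟩

theorem add_smul_dir_mem_blackRay (A : DirSeg) {s : ℝ} (h : 1 ≤ s) :
    A.1 + s • A.dir ∈ A.blackRay := ⟨s - 1, by linarith, by simp only [dir]; module⟩

theorem turn_whiteRay (p q : Plane) (A : DirSeg) (t : ℝ) :
    turn p q (A.1 - t • A.dir) = turn p q A.1 - t * wedge (q - p) A.dir := by
  rw [sub_eq_add_neg, ← neg_smul, turn_add_smul]; ring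

theorem turn_blackRay (p q : Plane) (A : DirSeg) (t : ℝ) :
    turn p q (A.2 + t • A.dir) = turn p q A.2 + t * wedge (q - p) A.dir := turn_add_smul _ _ _ _ _

theorem wedge_dir_self (A : DirSeg) : wedge (A.2 - A.1) A.dir = 0 := by
  simp only [wedge, dir, PiLp.sub_apply]; ring

theorem turn_eq_zero_of_mem_ray {A : DirSeg} {x : Plane} (hx : x ∈ A.whiteRay ∪ A.blackRay) :
    turn A.1 A.2 x = 0 := by
  rcases hx with ⟨t, _, rfl⟩ | ⟨t, _, rfl⟩
  · rw [turn_whiteRay, wedge_dir_self]; simp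
  · rw [turn_blackRay, wedge_dir_self]; simp

/-- The intersection point of two supporting lines that are not parallel. -/
theorem lines_meet (A B : DirSeg) (h : wedge A.dir B.dir ≠ 0) :
    A.1 + (turn B.1 B.2 A.1 / wedge A.dir B.dir) • A.dir =
      B.1 + (-turn A.1 A.2 B.1 / wedge A.dir B.dir) • B.dir := by
  apply plane_ext <;>
  · simp only [PiLp.add_apply, PiLp.smul_apply, smul_eq_mul]
    field_simp
    simp only [wedge, dir, turn, PiLp.sub_apply]
    ring

theorem Sided.not_rayHitsSegment {A B : DirSeg} (h : Sided A B) :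
    ¬ RayHitsSegment A B ∧ ¬ RayHitsSegment B A := by
  rw [sided_iff] at h
  constructor
  · rintro ⟨-, x, hx, hxB⟩
    exact (turn_neg_of_mem_segment hxB h.1.1 h.1.2).ne (turn_eq_zero_of_mem_ray hx)
  · rintro ⟨-, x, hx, hxA⟩
    exact (turn_pos_of_mem_segment hxA h.2.1 h.2.2).ne' (turn_eq_zero_of_mem_ray hx)

theorem turn_sub_eq_neg_wedge (A B : DirSeg) :
    turn B.1 B.2 A.2 - turn B.1 B.2 A.1 = -wedge A.dir B.dir := by
  rw [turn_sub_eq_wedge, wedge_swap]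

/-- For a comparable pair, white and black outer rays do not meet. -/
theorem Sided.disjoint_rays {A B : DirSeg} (h : Sided A B) :
    ¬ (A.whiteRay ∩ B.blackRay).Nonempty ∧ ¬ (B.whiteRay ∩ A.blackRay).Nonempty := by
  rw [sided_iff] at h
  obtain ⟨⟨h1, h2⟩, h3, h4⟩ := h
  have hw : wedge (B.2 - B.1) A.dir = -wedge A.dir B.dir := wedge_swap _ _
  have hw' : wedge (A.2 - A.1) B.dir = wedge A.dir B.dir := rfl
  constructor
  · rintro ⟨x, hA, hB⟩
    have e1 := turn_eq_zero_of_mem_ray (Or.inl hA)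
    have e2 := turn_eq_zero_of_mem_ray (Or.inr hB)
    obtain ⟨s, hs, rfl⟩ := hA
    obtain ⟨t, ht, hx⟩ := hB
    rw [turn_whiteRay, hw] at e2
    rw [hx, turn_blackRay, hw'] at e1
    have hD : 0 < wedge A.dir B.dir := by
      by_contra hD
      nlinarith [mul_nonneg ht (neg_nonneg.2 (not_lt.1 hD))]
    nlinarith [mul_nonneg hs hD.le]
  · rintro ⟨x, hB, hA⟩
    have e1 := turn_eq_zero_of_mem_ray (Or.inr hA)
    have e2 := turn_eq_zero_of_mem_ray (Or.inl hB)
    obtain ⟨s, hs, rfl⟩ := hA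
    obtain ⟨t, ht, hx⟩ := hB
    rw [turn_blackRay, hw] at e2
    rw [hx, turn_whiteRay, hw'] at e1
    have hD : wedge A.dir B.dir < 0 := by
      by_contra hD
      nlinarith [mul_nonneg ht (not_lt.1 hD)]
    nlinarith [mul_nonneg hs (neg_nonneg.2 hD.le)]

theorem wedge_smul_right (a b : Plane) (t : ℝ) : wedge a (t • b) = t * wedge a b := by
  simp only [wedge, PiLp.smul_apply, smul_eq_mul]; ring

theorem Sided.dir_ne_zero {A B : DirSeg} (h : Sided A B) : A.dir ≠ 0 ∧ B.dir ≠ 0 := by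
  rw [sided_iff] at h
  constructor <;> intro h0 <;> have h0 := sub_eq_zero.1 h0
  · rw [h0] at h; simp at h
  · rw [h0] at h; simp at h

theorem Sided.not_antiparallel {A B : DirSeg} (h : Sided A B) : ¬ Antiparallel A B := by
  intro hp
  obtain ⟨r, hr, he⟩ := hp.exists_pos_left h.dir_ne_zero.1 (neg_ne_zero.2 h.dir_ne_zero.2)
  rw [sided_iff] at h
  have e0 : B.2 0 - B.1 0 = -(r * (A.2 0 - A.1 0)) := by
    have := congrArg (fun v : Plane => v 0) he
    simp only [dir, PiLp.smul_apply, PiLp.neg_apply, PiLp.sub_apply, smul_eq_mul] at this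
    linarith
  have e1 : B.2 1 - B.1 1 = -(r * (A.2 1 - A.1 1)) := by
    have := congrArg (fun v : Plane => v 1) he
    simp only [dir, PiLp.smul_apply, PiLp.neg_apply, PiLp.sub_apply, smul_eq_mul] at this
    linarith
  have e2 : turn B.1 B.2 A.1 = r * turn A.1 A.2 B.1 := by
    unfold turn; rw [e0, e1]; ring
  nlinarith [h.1.1, h.2.1]

theorem Antiparallel.symm {A B : DirSeg} (h : Antiparallel A B) : Antiparallel B A := by
  unfold Antiparallel at h ⊢
  rw [← sameRay_neg_iff, neg_neg]
  exact SameRay.symm h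

theorem Sided.not_oppositeRaysMeet {A B : DirSeg} (h : Sided A B) :
    ¬ OppositeRaysMeet A B ∧ ¬ OppositeRaysMeet B A := by
  constructor
  · rintro ⟨-, h' | h'⟩
    · exact h.disjoint_rays.1 h'
    · exact h.not_antiparallel h'
  · rintro ⟨-, h' | h'⟩
    · exact h.disjoint_rays.2 h'
    · exact h.not_antiparallel h'.symm

/-- If the line through `A` crosses the segment `B`, the crossing point lies on an outer ray. -/
theorem Generic.rayHitsSegment {A B : DirSeg} (h : Generic A B) (hne : A ≠ B)
    (hα : turn A.1 A.2 B.1 * turn A.1 A.2 B.2 < 0) : RayHitsSegment A B := by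
  have hD := turn_sub_eq_wedge A B
  set α := turn A.1 A.2 B.1
  set α' := turn A.1 A.2 B.2
  have hD0 : wedge A.dir B.dir ≠ 0 := by
    intro h0; rw [h0] at hD
    have he : α' = α := by linarith
    rw [he] at hα
    nlinarith [mul_self_nonneg α]
  have hmeet := lines_meet A B hD0
  have hquot : -α / wedge A.dir B.dir = (-α * (α' - α)) / (α' - α) ^ 2 := by
    rw [hD]; field_simp
  have hDD : 0 < (α' - α) ^ 2 := by rw [hD]; positivity
  have hB : B.1 + (-α / wedge A.dir B.dir) • B.dir ∈ B.carrier := by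
    apply add_smul_dir_mem_carrier <;> rw [hquot]
    · apply div_nonneg _ hDD.le; nlinarith [sq_nonneg α]
    · rw [div_le_one hDD]; nlinarith [sq_nonneg α']
  refine ⟨hne, _, ?_, hB⟩
  rw [← hmeet]
  rcases le_total (turn B.1 B.2 A.1 / wedge A.dir B.dir) 0 with h0 | h0
  · exact Or.inl (add_smul_dir_mem_whiteRay A h0)
  rcases le_total 1 (turn B.1 B.2 A.1 / wedge A.dir B.dir) with h1 | h1
  · exact Or.inr (add_smul_dir_mem_blackRay A h1)
  rw [← hmeet] at hB
  exact absurd hB (Set.disjoint_left.1 h.disj (add_smul_dir_mem_carrier A h0 h1))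

theorem exists_smul_of_wedge_eq_zero {a b : Plane} (ha : a ≠ 0) (h : wedge a b = 0) :
    ∃ t : ℝ, b = t • a := by
  unfold wedge at h
  by_cases h0 : a 0 = 0
  · have h1 : a 1 ≠ 0 := fun h1 => ha (plane_ext h0 h1)
    have hb : b 0 = 0 := by
      rw [h0] at h
      have : a 1 * b 0 = 0 := by linarith
      exact (mul_eq_zero.1 this).resolve_left h1
    refine ⟨b 1 / a 1, plane_ext ?_ ?_⟩ <;> simp only [PiLp.smul_apply, smul_eq_mul]
    · rw [h0, hb]; ring
    · field_simp
  · refine ⟨b 0 / a 0, plane_ext ?_ ?_⟩ <;> simp only [PiLp.smul_apply, smul_eq_mul]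
    · field_simp
    · field_simp; linarith

theorem Generic.dir_ne_zero {A B : DirSeg} (h : Generic A B) : A.dir ≠ 0 := by
  intro h0
  exact h.left₁ (by rw [sub_eq_zero.1 h0]; simp)

/-- If each segment lies to the right of the other, or each to the left, then outer rays of
different colors meet, possibly at infinity. -/
theorem Generic.oppositeRaysMeet {A B : DirSeg} (h : Generic A B) (hne : A ≠ B)
    (hα : 0 < turn A.1 A.2 B.1 * turn A.1 A.2 B.2)
    (hβ : 0 < turn B.1 B.2 A.1 * turn B.1 B.2 A.2)
    (hαβ : 0 < turn A.1 A.2 B.1 * turn B.1 B.2 A.1) :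
    OppositeRaysMeet A B ∨ OppositeRaysMeet B A := by
  have hD := turn_sub_eq_wedge A B
  have hD' := turn_sub_eq_neg_wedge A B
  have hmeet := lines_meet A B
  by_cases hD0 : wedge A.dir B.dir = 0
  · left
    refine ⟨hne, Or.inr ?_⟩
    obtain ⟨t, ht⟩ := exists_smul_of_wedge_eq_zero h.dir_ne_zero hD0
    have e : turn B.1 B.2 A.1 = -t * turn A.1 A.2 B.1 := by
      have e0 : B.2 0 - B.1 0 = t * (A.2 0 - A.1 0) := congrArg (fun v : Plane => v 0) ht
      have e1 : B.2 1 - B.1 1 = t * (A.2 1 - A.1 1) := congrArg (fun v : Plane => v 1) ht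
      unfold turn; rw [e0, e1]; ring
    have htn : 0 < -t := by
      rw [e] at hαβ
      by_contra hcon
      nlinarith [mul_nonneg (neg_nonneg.2 (not_lt.1 hcon)) (sq_nonneg (turn A.1 A.2 B.1))]
    unfold Antiparallel
    rw [ht, ← neg_smul]
    exact SameRay.sameRay_nonneg_smul_right _ htn.le
  · have hmeet := hmeet hD0
    set α := turn A.1 A.2 B.1
    set α' := turn A.1 A.2 B.2
    set β := turn B.1 B.2 A.1
    set β' := turn B.1 B.2 A.2
    set D := wedge A.dir B.dir
    have hDD : 0 < D ^ 2 := by positivity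
    have q1 : β / D = β * D / D ^ 2 := by field_simp
    have q2 : -α / D = -α * D / D ^ 2 := by field_simp
    rcases lt_or_gt_of_ne h.left₁ with hs | hs
    · have hs : α < 0 := hs
      have k1 : α' < 0 := by nlinarith
      have k2 : β < 0 := by nlinarith
      have k3 : β' < 0 := by nlinarith
      rcases lt_or_gt_of_ne hD0 with hd | hd
      · right
        refine ⟨hne.symm, Or.inl ⟨B.1 + (-α / D) • B.dir, ?_, ?_⟩⟩
        · exact add_smul_dir_mem_whiteRay B
            (by rw [q2]; apply div_nonpos_of_nonpos_of_nonneg _ hDD.le; nlinarith)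
        · rw [← hmeet]
          exact add_smul_dir_mem_blackRay A (by rw [q1, le_div_iff₀ hDD]; nlinarith)
      · left
        refine ⟨hne, Or.inl ⟨A.1 + (β / D) • A.dir, ?_, ?_⟩⟩
        · exact add_smul_dir_mem_whiteRay A
            (by rw [q1]; apply div_nonpos_of_nonpos_of_nonneg _ hDD.le; nlinarith)
        · rw [hmeet]
          exact add_smul_dir_mem_blackRay B (by rw [q2, le_div_iff₀ hDD]; nlinarith)
    · have hs : 0 < α := hs
      have k1 : 0 < α' := by by_contra; nlinarith
      have k2 : 0 < β := by by_contra; nlinarith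
      have k3 : 0 < β' := by by_contra; nlinarith
      rcases lt_or_gt_of_ne hD0 with hd | hd
      · left
        refine ⟨hne, Or.inl ⟨A.1 + (β / D) • A.dir, ?_, ?_⟩⟩
        · exact add_smul_dir_mem_whiteRay A
            (by rw [q1]; apply div_nonpos_of_nonpos_of_nonneg _ hDD.le; nlinarith)
        · rw [hmeet]
          exact add_smul_dir_mem_blackRay B (by rw [q2, le_div_iff₀ hDD]; nlinarith)
      · right
        refine ⟨hne.symm, Or.inl ⟨B.1 + (-α / D) • B.dir, ?_, ?_⟩⟩
        · exact add_smul_dir_mem_whiteRay B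
            (by rw [q2]; apply div_nonpos_of_nonpos_of_nonneg _ hDD.le; nlinarith)
        · rw [← hmeet]
          exact add_smul_dir_mem_blackRay A (by rw [q1, le_div_iff₀ hDD]; nlinarith)

/-- Two segments in general position that avoid the first two patterns are comparable. -/
theorem Generic.sided_or_sided {A B : DirSeg} (h : Generic A B) (hne : A ≠ B)
    (h1 : ¬ RayHitsSegment A B) (h2 : ¬ RayHitsSegment B A)
    (h3 : ¬ OppositeRaysMeet A B) (h4 : ¬ OppositeRaysMeet B A) : Sided A B ∨ Sided B A := by
  have hα : 0 < turn A.1 A.2 B.1 * turn A.1 A.2 B.2 :=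
    lt_of_le_of_ne (not_lt.1 fun hc => h1 (h.rayHitsSegment hne hc))
      (mul_ne_zero h.left₁ h.left₂).symm
  have hβ : 0 < turn B.1 B.2 A.1 * turn B.1 B.2 A.2 :=
    lt_of_le_of_ne (not_lt.1 fun hc => h2 (h.symm.rayHitsSegment hne.symm hc))
      (mul_ne_zero h.right₁ h.right₂).symm
  have hαβ : turn A.1 A.2 B.1 * turn B.1 B.2 A.1 < 0 :=
    lt_of_le_of_ne (not_lt.1 fun hc => (h.oppositeRaysMeet hne hα hβ hc).elim h3 h4)
      (mul_ne_zero h.left₁ h.right₁)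
  rcases mul_neg_iff.1 hαβ with ⟨a, b⟩ | ⟨a, b⟩
  · exact Or.inr ⟨⟨b, neg_of_mul_pos_right hβ b.le⟩, a, pos_of_mul_pos_right hα a.le⟩
  · exact Or.inl ⟨⟨a, neg_of_mul_pos_right hα a.le⟩, b, pos_of_mul_pos_right hβ b.le⟩

/-- Comparable segments that converge towards their black ends have black outer rays that meet. -/
theorem Sided.blackRays_meet {A B : DirSeg} (h : Sided A B) (hD : 0 < wedge A.dir B.dir) :
    (A.blackRay ∩ B.blackRay).Nonempty := by
  have e1 := turn_sub_eq_wedge A B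
  have e2 := turn_sub_eq_neg_wedge A B
  rw [sided_iff] at h
  refine ⟨_, add_smul_dir_mem_blackRay A (s := turn B.1 B.2 A.1 / wedge A.dir B.dir) ?_, ?_⟩
  · rw [le_div_iff₀ hD]; linarith [h.2.2]
  · rw [lines_meet A B hD.ne']
    exact add_smul_dir_mem_blackRay B (by rw [le_div_iff₀ hD]; linarith [h.1.2])

/-- Comparable segments that converge towards their white ends have white outer rays that meet. -/
theorem Sided.whiteRays_meet {A B : DirSeg} (h : Sided A B) (hD : wedge A.dir B.dir < 0) :
    (A.whiteRay ∩ B.whiteRay).Nonempty := by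
  rw [sided_iff] at h
  refine ⟨_, add_smul_dir_mem_whiteRay A (s := turn B.1 B.2 A.1 / wedge A.dir B.dir) ?_, ?_⟩
  · exact div_nonpos_of_nonneg_of_nonpos h.2.1.le hD.le
  · rw [lines_meet A B hD.ne]
    exact add_smul_dir_mem_whiteRay B
      (div_nonpos_of_nonneg_of_nonpos (by linarith [h.1.1]) hD.le)

/-! ### Triples of segments -/

/-- The combination of the equations of three lines whose coefficients annihilate the three
directions is constant. -/
theorem turn_combination_const (A B C : DirSeg) (x y : Plane) :
    wedge B.dir C.dir * turn A.1 A.2 x + wedge C.dir A.dir * turn B.1 B.2 x +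
        wedge A.dir B.dir * turn C.1 C.2 x =
      wedge B.dir C.dir * turn A.1 A.2 y + wedge C.dir A.dir * turn B.1 B.2 y +
        wedge A.dir B.dir * turn C.1 C.2 y := by
  simp only [wedge, dir, turn, PiLp.sub_apply]; ring

/-- Three segments on parallel lines do not form a cycle; there the constant combination of the three
equations is trivial and gives no information. -/
theorem not_cycle_of_parallel {A B C : DirSeg} (hAB : Sided A B) (hBC : Sided B C)
    (hCA : Sided C A) (h1 : wedge A.dir B.dir = 0) (h2 : wedge A.dir C.dir = 0) : False := by
  obtain ⟨s, hs⟩ := exists_smul_of_wedge_eq_zero hAB.dir_ne_zero.1 h1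
  obtain ⟨t, ht⟩ := exists_smul_of_wedge_eq_zero hAB.dir_ne_zero.1 h2
  have s0 : B.2 0 - B.1 0 = s * (A.2 0 - A.1 0) := congrArg (fun v : Plane => v 0) hs
  have s1 : B.2 1 - B.1 1 = s * (A.2 1 - A.1 1) := congrArg (fun v : Plane => v 1) hs
  have t0 : C.2 0 - C.1 0 = t * (A.2 0 - A.1 0) := congrArg (fun v : Plane => v 0) ht
  have t1 : C.2 1 - C.1 1 = t * (A.2 1 - A.1 1) := congrArg (fun v : Plane => v 1) ht
  have eB : ∀ x, turn B.1 B.2 x = s * (turn A.1 A.2 x - turn A.1 A.2 B.1) := by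
    intro x; unfold turn; rw [s0, s1]; ring
  have eC : ∀ x, turn C.1 C.2 x = t * (turn A.1 A.2 x - turn A.1 A.2 C.1) := by
    intro x; unfold turn; rw [t0, t1]; ring
  rw [sided_iff] at hAB hBC hCA
  obtain ⟨⟨a1, -⟩, a2, -⟩ := hAB
  obtain ⟨⟨b1, -⟩, b2, -⟩ := hBC
  obtain ⟨⟨c1, -⟩, c2, -⟩ := hCA
  rw [eB, turn_left] at a2
  rw [eB] at b1
  -- Here `B` is directed like `A` because it has `A` on its left.
  have hs0 : 0 < s := by by_contra hcon; nlinarith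
  nlinarith

/-- Sign bookkeeping for `cycle_signs`: `p`, `q`, `r` are the cross products of consecutive
directions, and `h1`, `h2` compare the values of the constant combination at the three
segments. -/
theorem signs_of_mixed {p q r x y z w s t : ℝ} (hx : 0 < x) (hy : 0 < y) (hz : 0 < z)
    (hw : 0 < w) (hs : 0 < s) (ht : 0 < t) (h1 : q * x - r * y = r * z - p * w)
    (h2 : r * z - p * w = p * s - q * t) (hq : 0 ≤ q) (hr : r ≤ 0) : q = 0 ∧ r = 0 := by
  have hqx := mul_nonneg hq hx.le
  have hqt := mul_nonneg hq ht.le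
  have hry := mul_nonneg (neg_nonneg.2 hr) hy.le
  have hrz := mul_nonneg (neg_nonneg.2 hr) hz.le
  have hp : 0 ≤ p := by by_contra hcon; nlinarith [mul_pos (neg_pos.2 (not_le.1 hcon)) hs]
  have hpw := mul_nonneg hp hw.le
  constructor
  · exact (mul_eq_zero.1 (show q * x = 0 by linarith)).resolve_right hx.ne'
  · exact (mul_eq_zero.1 (show r * y = 0 by linarith)).resolve_right hy.ne'

/-- In a cycle of the sidedness relation, the three directions turn consistently. -/
theorem cycle_signs {A B C : DirSeg} (hAB : Sided A B) (hBC : Sided B C) (hCA : Sided C A) :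
    (0 < wedge A.dir B.dir ∧ 0 < wedge B.dir C.dir ∧ 0 < wedge C.dir A.dir) ∨
      (wedge A.dir B.dir < 0 ∧ wedge B.dir C.dir < 0 ∧ wedge C.dir A.dir < 0) := by
  have k1 := turn_combination_const A B C A.1 B.1
  have k2 := turn_combination_const A B C B.1 C.1
  have p1 : wedge B.dir C.dir = 0 → wedge A.dir B.dir ≠ 0 := fun h1 h2 =>
    not_cycle_of_parallel hBC hCA hAB h1 (by rw [wedge_swap, h2, neg_zero])
  rw [sided_iff] at hAB hBC hCA
  obtain ⟨⟨a1, -⟩, a2, -⟩ := hAB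
  obtain ⟨⟨b1, -⟩, b2, -⟩ := hBC
  obtain ⟨⟨c1, -⟩, c2, -⟩ := hCA
  simp only [turn_left, mul_zero, zero_add, add_zero] at k1 k2
  rw [← neg_pos] at a1 b1 c1
  set p := wedge B.dir C.dir
  set q := wedge C.dir A.dir
  set r := wedge A.dir B.dir
  have m1 := signs_of_mixed (p := p) (q := q) (r := r) a2 c1 b2 a1 c2 b1
    (by linarith) (by linarith)
  have m2 := signs_of_mixed (p := q) (q := r) (r := p) b2 a1 c2 b1 a2 c1
    (by linarith) (by linarith)
  have m3 := signs_of_mixed (p := r) (q := p) (r := q) c2 b1 a2 c1 b2 a1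
    (by linarith) (by linarith)
  rcases lt_trichotomy r 0 with hr | hr | hr
  · have hq : q < 0 := by by_contra hq; exact hr.ne (m1 (not_lt.1 hq) hr.le).2
    have hp : p < 0 := by by_contra hp; exact hq.ne (m3 (not_lt.1 hp) hq.le).2
    exact Or.inr ⟨hr, hp, hq⟩
  · have hp : 0 < p := by
      by_contra hp; exact p1 (m2 hr.ge (not_lt.1 hp)).2 hr
    have hq : 0 < q := by by_contra hq; exact hp.ne' (m3 hp.le (not_lt.1 hq)).1
    exact absurd (m1 hq.le hr.le).1 hq.ne'
  · have hp : 0 < p := by by_contra hp; exact hr.ne' (m2 hr.le (not_lt.1 hp)).1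
    have hq : 0 < q := by by_contra hq; exact hp.ne' (m3 hp.le (not_lt.1 hq)).1
    exact Or.inl ⟨hr, hp, hq⟩

/-- The relation between three directions, applied to the position of `C` relative to `A`. -/
theorem wedge_mul_turn (A B C : DirSeg) :
    wedge B.dir C.dir * turn A.1 A.2 C.1 =
      wedge A.dir C.dir * (turn B.1 B.2 C.1 - turn B.1 B.2 A.1) +
        wedge A.dir B.dir * turn C.1 C.2 A.1 := by
  simp only [wedge, dir, turn, PiLp.sub_apply]; ring

/-- Sign bookkeeping for `not_source_of_cycle`: `x`, `y`, `z` are the cross products of a direction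
with three directions that positively span the plane. -/
theorem false_of_positive_span {p q r x y z t₁ t₂ t₃ f₁ f₂ f₃ g₁ g₂ g₃ : ℝ} (hp : 0 < p)
    (hq : 0 < q) (hr : 0 < r) (ht₁ : t₁ < 0) (ht₂ : t₂ < 0) (ht₃ : t₃ < 0) (hf₁ : f₁ < 0)
    (hf₂ : f₂ < 0) (hf₃ : f₃ < 0) (hg₁ : 0 < g₁) (hg₂ : 0 < g₂) (hg₃ : 0 < g₃)
    (h : p * x + q * y + r * z = 0) (h₁ : r * t₁ = y * (f₁ - g₁) + x * g₂)
    (h₂ : p * t₂ = z * (f₂ - g₂) + y * g₃) (h₃ : q * t₃ = x * (f₃ - g₃) + z * g₁) : False := by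
  have cone : ∀ {w u v t f g k : ℝ}, 0 < w → t < 0 → f < 0 → 0 < g → 0 < k →
      w * t = v * (f - g) + u * k → 0 ≤ u → 0 < v := by
    intro w u v t f g k hw ht hf hg hk he hu
    by_contra hv
    have h1 := mul_neg_of_pos_of_neg hw ht
    have h2 := mul_nonneg hu hk.le
    have h3 := mul_nonneg_of_nonpos_of_nonpos (not_lt.1 hv) (show f - g ≤ 0 by linarith)
    linarith
  have c1 := cone hr ht₁ hf₁ hg₁ hg₂ h₁
  have c2 := cone hp ht₂ hf₂ hg₂ hg₃ h₂
  have c3 := cone hq ht₃ hf₃ hg₃ hg₁ h₃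
  rcases le_or_gt 0 x with hx | hx
  · have hy := c1 hx
    have hz := c2 hy.le
    have := mul_nonneg hp.le hx
    have := mul_pos hq hy
    have := mul_pos hr hz
    linarith
  · have hz : z < 0 := by by_contra hz; exact hx.not_gt (c3 (not_lt.1 hz))
    have hy : y < 0 := by by_contra hy; exact hz.not_gt (c2 (not_lt.1 hy))
    have := mul_neg_of_pos_of_neg hp hx
    have := mul_neg_of_pos_of_neg hq hy
    have := mul_neg_of_pos_of_neg hr hz
    linarith

/-- A segment is not to the left of all three segments of a cycle of the sidedness relation: the
opposite of its direction would be a nonnegative combination of two consecutive directions of the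
cycle, and this puts a point of the cycle on its left. -/
theorem not_source_of_cycle {A B C D : DirSeg} (hAB : Sided A B) (hAC : Sided A C)
    (hAD : Sided A D) (hBC : Sided B C) (hCD : Sided C D) (hDB : Sided D B) : False := by
  have hrel : wedge C.dir D.dir * wedge A.dir B.dir + wedge D.dir B.dir * wedge A.dir C.dir +
      wedge B.dir C.dir * wedge A.dir D.dir = 0 := by unfold wedge; ring
  have i1 := wedge_mul_turn A B C
  have i2 := wedge_mul_turn A C D
  have i3 := wedge_mul_turn A D B
  rcases cycle_signs hBC hCD hDB with ⟨hr, hp, hq⟩ | ⟨hr, hp, hq⟩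
  · exact false_of_positive_span hp hq hr hAC.1.1 hAD.1.1 hAB.1.1 hBC.1.1 hCD.1.1 hDB.1.1
      hAB.2.1 hAC.2.1 hAD.2.1 hrel i1 i2 i3
  · rw [← neg_pos] at hr hp hq
    exact false_of_positive_span (x := -wedge A.dir B.dir) (y := -wedge A.dir C.dir)
      (z := -wedge A.dir D.dir) hp hq hr hAC.1.1 hAD.1.1 hAB.1.1 hBC.1.1 hCD.1.1 hDB.1.1
      hAB.2.1 hAC.2.1 hAD.2.1 (by linarith) (by linarith) (by linarith) (by linarith)

end DirSeg

/-! ### Comparability and patterns in a matching -/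

open DirSeg

theorem IsBichromatic.turn_ne_zero {n : ℕ} {W B : Finset Plane} (hF : IsBichromatic n W B)
    {p q r : Plane} (hp : p ∈ (W ∪ B : Set Plane)) (hq : q ∈ (W ∪ B : Set Plane))
    (hr : r ∈ (W ∪ B : Set Plane)) (hpq : p ≠ q) (hpr : p ≠ r) (hqr : q ≠ r) :
    turn p q r ≠ 0 := fun h =>
  hF.general_position p hp q hq r hr hpq hpr hqr (collinear_of_turn_eq_zero h)

namespace IsBRMatching

variable {n : ℕ} {W B : Finset Plane} {M : Finset DirSeg}

theorem mem_fst (hM : IsBRMatching W B M) {A : DirSeg} (hA : A ∈ M) :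
    A.1 ∈ (W ∪ B : Set Plane) := Or.inl (hM.ends A hA).1

theorem mem_snd (hM : IsBRMatching W B M) {A : DirSeg} (hA : A ∈ M) :
    A.2 ∈ (W ∪ B : Set Plane) := Or.inr (hM.ends A hA).2

theorem eq_of_fst (hM : IsBRMatching W B M) {A A' : DirSeg} (hA : A ∈ M) (hA' : A' ∈ M)
    (h : A.1 = A'.1) : A = A' :=
  (hM.white A'.1 (hM.ends A' hA').1).unique ⟨hA, h⟩ ⟨hA', rfl⟩

theorem eq_of_snd (hM : IsBRMatching W B M) {A A' : DirSeg} (hA : A ∈ M) (hA' : A' ∈ M)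
    (h : A.2 = A'.2) : A = A' :=
  (hM.black A'.2 (hM.ends A' hA').2).unique ⟨hA, h⟩ ⟨hA', rfl⟩

theorem fst_ne_snd (hF : IsBichromatic n W B) (hM : IsBRMatching W B M) {A A' : DirSeg}
    (hA : A ∈ M) (hA' : A' ∈ M) : A.1 ≠ A'.2 :=
  Finset.disjoint_iff_ne.1 hF.disj _ (hM.ends A hA).1 _ (hM.ends A' hA').2

theorem dir_ne_zero (hF : IsBichromatic n W B) (hM : IsBRMatching W B M) {A : DirSeg}
    (hA : A ∈ M) : A.dir ≠ 0 :=
  sub_ne_zero.2 (fst_ne_snd hF hM hA hA).symm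

/-- Distinct segments of a matching are in general position. -/
theorem generic (hF : IsBichromatic n W B) (hM : IsBRMatching W B M) {A A' : DirSeg}
    (hA : A ∈ M) (hA' : A' ∈ M) (hne : A ≠ A') : Generic A A' where
  left₁ := hF.turn_ne_zero (hM.mem_fst hA) (hM.mem_snd hA) (hM.mem_fst hA')
    (fst_ne_snd hF hM hA hA) (fun h => hne (hM.eq_of_fst hA hA' h)) (fst_ne_snd hF hM hA' hA).symm
  left₂ := hF.turn_ne_zero (hM.mem_fst hA) (hM.mem_snd hA) (hM.mem_snd hA')
    (fst_ne_snd hF hM hA hA) (fst_ne_snd hF hM hA hA') (fun h => hne (hM.eq_of_snd hA hA' h))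
  right₁ := hF.turn_ne_zero (hM.mem_fst hA') (hM.mem_snd hA') (hM.mem_fst hA)
    (fst_ne_snd hF hM hA' hA') (fun h => hne (hM.eq_of_fst hA hA' h.symm))
    (fst_ne_snd hF hM hA hA').symm
  right₂ := hF.turn_ne_zero (hM.mem_fst hA') (hM.mem_snd hA') (hM.mem_snd hA)
    (fst_ne_snd hF hM hA' hA') (fst_ne_snd hF hM hA' hA)
    (fun h => hne (hM.eq_of_snd hA hA' h.symm))
  disj := hM.noncrossing A hA A' hA' hne

end IsBRMatching

/-- Any two distinct segments are related by the sidedness relation. -/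
def PairwiseSided (M : Finset DirSeg) : Prop :=
  ∀ A ∈ M, ∀ A' ∈ M, A ≠ A' → Sided A A' ∨ Sided A' A

/-- The sidedness relation has no cycle of length three. -/
def NoSidedCycle (M : Finset DirSeg) : Prop :=
  ∀ A ∈ M, ∀ A' ∈ M, ∀ A'' ∈ M, Sided A A' → Sided A' A'' → ¬ Sided A'' A

theorem isStrictTotalOrder_iff {M : Finset DirSeg} :
    IsStrictTotalOrder {A : DirSeg // A ∈ M} (fun A A' => Sided A.1 A'.1) ↔
      PairwiseSided M ∧ NoSidedCycle M := by
  constructor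
  · intro h
    refine ⟨fun A hA A' hA' hne => ?_, fun A hA A' hA' A'' hA'' h1 h2 h3 => ?_⟩
    · by_contra hcon
      push Not at hcon
      exact hne (congrArg Subtype.val
        (h.toTrichotomous.trichotomous ⟨A, hA⟩ ⟨A', hA'⟩ hcon.1 hcon.2))
    · have := h.toIsStrictOrder.toIsTrans.trans ⟨A, hA⟩ ⟨A', hA'⟩ ⟨A'', hA''⟩ h1 h2
      exact this.asymm h3
  · rintro ⟨h1, h2⟩
    refine { trichotomous := ?_, irrefl := ?_, trans := ?_ }
    · rintro ⟨A, hA⟩ ⟨A', hA'⟩ n1 n2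
      by_contra hne
      exact (h1 A hA A' hA' (fun h => hne (Subtype.ext h))).elim n1 n2
    · rintro ⟨A, hA⟩ h
      exact h.ne rfl
    · rintro ⟨A, hA⟩ ⟨A', hA'⟩ ⟨A'', hA''⟩ h h'
      have hne : A ≠ A'' := by rintro rfl; exact h.asymm h'
      exact (h1 A hA A'' hA'' hne).resolve_right (h2 A hA A' hA' A'' hA'' h h')

/-- A triple of pairwise comparable segments is a cycle as soon as the lines of two of them separate
the other two segments. -/
theorem cycle_of_separates {M : Finset DirSeg} (hP : PairwiseSided M) {A B C : DirSeg}
    (hA : A ∈ M) (hB : B ∈ M) (hC : C ∈ M) (h1 : Separates A B C) (h2 : Separates B A C) :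
    (Sided A B ∧ Sided B C ∧ Sided C A) ∨ (Sided C B ∧ Sided B A ∧ Sided A C) := by
  have hself : ∀ X : DirSeg, ¬ LiesLeft X X := fun X h => by
    have := h.1; unfold PtLeft at this; simp at this
  have hself' : ∀ X : DirSeg, ¬ LiesRight X X := fun X h => by
    have := h.1; unfold PtRight at this; simp at this
  have hLR : ∀ X Y : DirSeg, LiesLeft X Y → ¬ LiesRight X Y := fun X Y h h' => lt_asymm h.1 h'.1
  -- In a comparable pair the side of one segment determines the order.
  have left : ∀ X ∈ M, ∀ Y ∈ M, LiesLeft X Y → Sided Y X := fun X hX Y hY h =>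
    (hP X hX Y hY (by rintro rfl; exact hself _ h)).resolve_left fun h' => hLR _ _ h h'.1
  have right : ∀ X ∈ M, ∀ Y ∈ M, LiesRight X Y → Sided X Y := fun X hX Y hY h =>
    (hP X hX Y hY (by rintro rfl; exact hself' _ h)).resolve_right fun h' => hLR _ _ h'.2 h
  rcases h1 with ⟨a, b⟩ | ⟨a, b⟩ <;> rcases h2 with ⟨c, d⟩ | ⟨c, d⟩
  · exact absurd (left _ hA _ hB a) (left _ hB _ hA c).asymm
  · exact Or.inr ⟨left _ hB _ hC d, left _ hA _ hB a, right _ hA _ hC b⟩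
  · exact Or.inl ⟨right _ hA _ hB a, right _ hB _ hC d, left _ hA _ hC b⟩
  · exact absurd (right _ hA _ hB a) (right _ hB _ hA c).asymm

theorem pairwiseSided_of_avoids {n : ℕ} {W B : Finset Plane} {M : Finset DirSeg}
    (hF : IsBichromatic n W B) (hM : IsBRMatching W B M)
    (h1 : ∀ A ∈ M, ∀ A' ∈ M, ¬ RayHitsSegment A A')
    (h2 : ∀ A ∈ M, ∀ A' ∈ M, ¬ OppositeRaysMeet A A') : PairwiseSided M :=
  fun A hA A' hA' hne => (IsBRMatching.generic hF hM hA hA' hne).sided_or_sided hne (h1 A hA A' hA')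
    (h1 A' hA' A hA) (h2 A hA A' hA') (h2 A' hA' A hA)

theorem avoidsPatterns_iff {n : ℕ} {W B : Finset Plane} {M : Finset DirSeg}
    (hF : IsBichromatic n W B) (hM : IsBRMatching W B M) :
    AvoidsPatterns M ↔ PairwiseSided M ∧ NoSidedCycle M := by
  constructor
  · rintro ⟨h1, h2, h3⟩
    refine ⟨pairwiseSided_of_avoids hF hM h1 h2,
      fun A hA A' hA' A'' hA'' s1 s2 s3 => h3 A hA A' hA' A'' hA'' ⟨?_, ?_, ?_, ?_⟩⟩
    · have comm : ∀ S T : Set Plane, (S ∩ T).Nonempty → (T ∩ S).Nonempty := fun S T h => by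
        rwa [Set.inter_comm]
      rcases cycle_signs s1 s2 s3 with ⟨d1, d2, d3⟩ | ⟨d1, d2, d3⟩
      · exact Or.inr ⟨s1.blackRays_meet d1, s2.blackRays_meet d2, comm _ _ (s3.blackRays_meet d3)⟩
      · exact Or.inl ⟨s1.whiteRays_meet d1, s2.whiteRays_meet d2, comm _ _ (s3.whiteRays_meet d3)⟩
    · exact Or.inr ⟨s1.1, s3.2⟩
    · exact Or.inl ⟨s1.2, s2.1⟩
    · exact Or.inr ⟨s3.1, s2.2⟩
  · rintro ⟨hP, hC⟩
    refine ⟨fun A hA A' hA' h => ?_, fun A hA A' hA' h => ?_, fun A hA A' hA' A'' hA'' h => ?_⟩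
    · rcases hP A hA A' hA' h.1 with s | s
      · exact s.not_rayHitsSegment.1 h
      · exact s.not_rayHitsSegment.2 h
    · rcases hP A hA A' hA' h.1 with s | s
      · exact s.not_oppositeRaysMeet.1 h
      · exact s.not_oppositeRaysMeet.2 h
    · rcases cycle_of_separates hP hA hA' hA'' h.2.1 h.2.2.1 with ⟨a, b, c⟩ | ⟨a, b, c⟩
      · exact hC A hA A' hA' A'' hA'' a b c
      · exact hC A'' hA'' A' hA' A hA a b c

/-! ### Quasi-parallel matchings -/

theorem inner_add_smul (u x v : Plane) (t : ℝ) :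
    inner ℝ u (x + t • v) = inner ℝ u x + t * inner ℝ u v := by
  rw [inner_add_right, inner_smul_right]

theorem DirSeg.exists_of_mem_line {A : DirSeg} {x : Plane} (hx : x ∈ A.line) :
    ∃ t : ℝ, x = A.1 + t • A.dir := by
  obtain ⟨t, rfl⟩ := mem_affineSpan_pair_iff_exists_lineMap_eq.1 hx
  exact ⟨t, by simp [AffineMap.lineMap_apply, dir, add_comm]⟩

theorem DirSeg.exists_of_mem_carrier {A : DirSeg} {x : Plane} (hx : x ∈ A.carrier) :
    ∃ t : ℝ, 0 ≤ t ∧ t ≤ 1 ∧ x = A.1 + t • A.dir := segment_combo hx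

theorem DirSeg.carrier_subset_line {A : DirSeg} {x : Plane} (hx : x ∈ A.carrier) : x ∈ A.line :=
  (affineSpan ℝ {A.1, A.2}).convex.segment_subset (left_mem_affineSpan_pair ℝ _ _)
    (right_mem_affineSpan_pair ℝ _ _) hx

theorem DirSeg.add_smul_dir_mem_line (A : DirSeg) (t : ℝ) : A.1 + t • A.dir ∈ A.line :=
  mem_affineSpan_pair_iff_exists_lineMap_eq.2
    ⟨t, by simp [AffineMap.lineMap_apply, dir, add_comm]⟩

theorem DirSeg.mem_line_of_mem_ray {A : DirSeg} {x : Plane} (hx : x ∈ A.whiteRay ∪ A.blackRay) :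
    x ∈ A.line := by
  rcases hx with ⟨t, _, rfl⟩ | ⟨t, _, rfl⟩
  · have := A.add_smul_dir_mem_line (-t)
    rwa [neg_smul, ← sub_eq_add_neg] at this
  · have := A.add_smul_dir_mem_line (1 + t)
    have e : A.1 + (1 + t) • A.dir = A.2 + t • A.dir := by simp only [dir]; module
    rwa [e] at this

/-- The lines of comparable segments directed alike meet before both segments or after both. -/
theorem DirSeg.Sided.inner_lt_or_lt {A B : DirSeg} (h : Sided A B) {u : Plane}
    (hA : 0 < inner ℝ u A.dir) (hB : 0 < inner ℝ u B.dir) {x : Plane} (hxA : x ∈ A.line)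
    (hxB : x ∈ B.line) :
    (∀ y ∈ A.carrier ∪ B.carrier, inner ℝ u x < inner ℝ u y) ∨
      (∀ y ∈ A.carrier ∪ B.carrier, inner ℝ u y < inner ℝ u x) := by
  obtain ⟨s, hs⟩ := exists_of_mem_line hxA
  obtain ⟨t, ht⟩ := exists_of_mem_line hxB
  have d1 := turn_sub_eq_wedge A B
  have d2 := turn_sub_eq_neg_wedge A B
  have e1 : turn A.1 A.2 B.1 + t * wedge A.dir B.dir = 0 := by
    have h1 : turn A.1 A.2 x = turn A.1 A.2 B.1 + t * wedge A.dir B.dir := by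
      rw [ht, turn_add_smul]; rfl
    have h2 : turn A.1 A.2 x = 0 := by rw [hs, turn_add_smul, wedge_dir_self]; simp
    linarith
  have e2 : turn B.1 B.2 A.1 - s * wedge A.dir B.dir = 0 := by
    have h1 : turn B.1 B.2 x = turn B.1 B.2 A.1 + s * wedge B.dir A.dir := by
      rw [hs, turn_add_smul]; rfl
    have h2 : turn B.1 B.2 x = 0 := by rw [ht, turn_add_smul, wedge_dir_self]; simp
    rw [wedge_swap A.dir] at h1
    linarith
  rw [sided_iff] at h
  obtain ⟨⟨h1, h2⟩, h3, h4⟩ := h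
  set D := wedge A.dir B.dir
  rcases lt_trichotomy D 0 with hD | hD | hD
  · left
    have hs0 : s < 0 := by by_contra hcon; nlinarith
    have ht0 : t < 0 := by by_contra hcon; nlinarith
    rintro y (hy | hy)
    · obtain ⟨r, hr0, -, rfl⟩ := exists_of_mem_carrier hy
      rw [hs, inner_add_smul, inner_add_smul]; nlinarith
    · obtain ⟨r, hr0, -, rfl⟩ := exists_of_mem_carrier hy
      rw [ht, inner_add_smul, inner_add_smul]; nlinarith
  · rw [hD] at e1; linarith
  · right
    have hs0 : 1 < s := by by_contra hcon; nlinarith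
    have ht0 : 1 < t := by by_contra hcon; nlinarith
    rintro y (hy | hy)
    · obtain ⟨r, -, hr1, rfl⟩ := exists_of_mem_carrier hy
      rw [hs, inner_add_smul, inner_add_smul]; nlinarith
    · obtain ⟨r, -, hr1, rfl⟩ := exists_of_mem_carrier hy
      rw [ht, inner_add_smul, inner_add_smul]; nlinarith

/-- The directions of a linearly ordered matching lie in an open half-plane: if a convex
combination of them vanished, the same combination of the equations of the lines would be constant,
but it is positive on the first segment involved and negative on the last one. -/
theorem zero_notMem_convexHull_dir {n : ℕ} {W B : Finset Plane} {M : Finset DirSeg}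
    (hF : IsBichromatic n W B) (hM : IsBRMatching W B M)
    (hO : IsStrictTotalOrder {A : DirSeg // A ∈ M} (fun A A' => Sided A.1 A'.1)) :
    (0 : Plane) ∉ convexHull ℝ (Set.range fun A : {A : DirSeg // A ∈ M} => A.1.dir) := by
  classical
  let : LinearOrder {A : DirSeg // A ∈ M} :=
    linearOrderOfSTO (fun A A' : {A : DirSeg // A ∈ M} => Sided A.1 A'.1)
  have hlt : ∀ {A A' : {A : DirSeg // A ∈ M}}, A < A' → Sided A.1 A'.1 := fun h => h
  rw [convexHull_range_eq_exists_affineCombination]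
  rintro ⟨s, w, hw0, hw1, hw⟩
  rw [s.affineCombination_eq_linear_combination _ _ hw1] at hw
  have hc : ∀ i : Fin 2, ∑ A ∈ s, w A * (A.1.dir) i = 0 := by
    intro i
    have := congrArg (fun v : Plane => v i) hw
    simpa using this
  have hconst : ∀ x y : Plane, ∑ A ∈ s, w A * turn A.1.1 A.1.2 x =
      ∑ A ∈ s, w A * turn A.1.1 A.1.2 y := by
    intro x y
    have e : ∀ A : {A : DirSeg // A ∈ M}, w A * turn A.1.1 A.1.2 x - w A * turn A.1.1 A.1.2 y =
        (w A * (A.1.dir) 0) * (x 1 - y 1) - (w A * (A.1.dir) 1) * (x 0 - y 0) := by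
      intro A; simp only [turn, dir, PiLp.sub_apply]; ring
    rw [← sub_eq_zero, ← Finset.sum_sub_distrib, Finset.sum_congr rfl fun A _ => e A,
      Finset.sum_sub_distrib, ← Finset.sum_mul, ← Finset.sum_mul, hc, hc]
    ring
  set T := s.filter fun A => w A ≠ 0 with hT
  have hTne : T.Nonempty := by
    by_contra hcon
    rw [Finset.not_nonempty_iff_eq_empty, Finset.filter_eq_empty_iff] at hcon
    rw [Finset.sum_eq_zero (fun A hA => not_not.1 (hcon hA))] at hw1
    exact zero_ne_one hw1
  have first := T.min'_mem hTne
  have last := T.max'_mem hTne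
  set A₀ := T.min' hTne
  set A₁ := T.max' hTne
  have pos : ∀ A ∈ s, 0 ≤ w A * turn A.1.1 A.1.2 A₀.1.1 := by
    intro A hA
    by_cases h0 : w A = 0
    · simp [h0]
    apply mul_nonneg (hw0 A hA)
    rcases (T.min'_le A (Finset.mem_filter.2 ⟨hA, h0⟩)).eq_or_lt with h | h
    · rw [show A₀ = A from h]; simp
    · exact (hlt h).2.1.le
  have neg : ∀ A ∈ s, w A * turn A.1.1 A.1.2 A₁.1.1 ≤ 0 := by
    intro A hA
    by_cases h0 : w A = 0
    · simp [h0]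
    apply mul_nonpos_of_nonneg_of_nonpos (hw0 A hA)
    rcases (T.le_max' A (Finset.mem_filter.2 ⟨hA, h0⟩)).eq_or_lt with h | h
    · rw [show A₁ = A from h.symm]; simp
    · exact (hlt h).1.1.le
  have hzero : ∑ A ∈ s, w A * turn A.1.1 A.1.2 A₀.1.1 = 0 :=
    le_antisymm ((hconst _ A₁.1.1).trans_le (Finset.sum_nonpos neg)) (Finset.sum_nonneg pos)
  rw [Finset.sum_eq_zero_iff_of_nonneg pos] at hzero
  have huniq : ∀ A ∈ s, w A ≠ 0 → A = A₀ := by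
    intro A hA h0
    by_contra hne
    have hlt' : A₀ < A :=
      lt_of_le_of_ne (T.min'_le A (Finset.mem_filter.2 ⟨hA, h0⟩)) (Ne.symm hne)
    exact (mul_ne_zero h0 (hlt hlt').2.1.ne') (hzero A hA)
  have hA₀ := Finset.mem_filter.1 first
  rw [Finset.sum_eq_single_of_mem A₀ hA₀.1 (fun A hA hne => by
    rw [show w A = 0 from by_contra fun h0 => hne (huniq A hA h0), zero_smul])] at hw
  exact (smul_ne_zero hA₀.2 (IsBRMatching.dir_ne_zero hF hM A₀.2)) hw

/-- A linearly ordered matching is directed along a common line. -/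
theorem exists_inner_dir_pos {n : ℕ} {W B : Finset Plane} {M : Finset DirSeg}
    (hF : IsBichromatic n W B) (hM : IsBRMatching W B M)
    (hO : IsStrictTotalOrder {A : DirSeg // A ∈ M} (fun A A' => Sided A.1 A'.1)) :
    ∃ u : Plane, ∀ A ∈ M, 0 < inner ℝ u A.dir := by
  obtain ⟨f, c, h0, hf⟩ := geometric_hahn_banach_point_closed (convex_convexHull ℝ _)
    ((Set.finite_range _).isClosed_convexHull ℝ) (zero_notMem_convexHull_dir hF hM hO)
  refine ⟨(InnerProductSpace.toDual ℝ Plane).symm f, fun A hA => ?_⟩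
  rw [InnerProductSpace.toDual_symm_apply]
  have := hf A.dir (subset_convexHull ℝ _ ⟨⟨A, hA⟩, rfl⟩)
  rw [map_zero] at h0
  linarith

theorem isQuasiParallel_of_isStrictTotalOrder {n : ℕ} (hn : 1 ≤ n) {W B : Finset Plane}
    {M : Finset DirSeg} (hF : IsBichromatic n W B) (hM : IsBRMatching W B M)
    (hO : IsStrictTotalOrder {A : DirSeg // A ∈ M} (fun A A' => Sided A.1 A'.1)) :
    IsQuasiParallel M := by
  obtain ⟨u, hu⟩ := exists_inner_dir_pos hF hM hO
  refine ⟨u, ?_, fun A hA => (hu A hA).ne', hu, ?_⟩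
  · rintro rfl
    obtain ⟨p, hp⟩ : W.Nonempty := by rw [← Finset.card_pos, hF.card_white]; exact hn
    obtain ⟨A, ⟨hA, -⟩, -⟩ := hM.white p hp
    simpa using hu A hA
  · intro A hA A' hA' hnp x hxA hxA' hx
    have hne : A ≠ A' := by rintro rfl; exact hnp (SameRay.refl _)
    have key : (∀ y ∈ A.carrier ∪ A'.carrier, inner ℝ u x < inner ℝ u y) ∨
        (∀ y ∈ A.carrier ∪ A'.carrier, inner ℝ u y < inner ℝ u x) := by
      rcases (isStrictTotalOrder_iff.1 hO).1 A hA A' hA' hne with s | s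
      · exact s.inner_lt_or_lt (hu A hA) (hu A' hA') hxA hxA'
      · rw [Set.union_comm]
        exact s.inner_lt_or_lt (hu A' hA') (hu A hA) hxA' hxA
    rcases key with h | h
    · have : convexHull ℝ ((fun y : Plane => inner ℝ u y) '' (A.carrier ∪ A'.carrier)) ⊆
          Set.Ioi (inner ℝ u x) :=
        convexHull_min (by rintro _ ⟨y, hy, rfl⟩; exact h y hy) (convex_Ioi _)
      exact lt_irrefl (inner ℝ u x) (this hx)
    · have : convexHull ℝ ((fun y : Plane => inner ℝ u y) '' (A.carrier ∪ A'.carrier)) ⊆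
          Set.Iio (inner ℝ u x) :=
        convexHull_min (by rintro _ ⟨y, hy, rfl⟩; exact h y hy) (convex_Iio _)
      exact lt_irrefl (inner ℝ u x) (this hx)

/-- Parallel segments in general position have disjoint supporting lines. -/
theorem DirSeg.Generic.not_parallel_of_mem_lines {A B : DirSeg} (h : Generic A B) {x : Plane}
    (hxA : x ∈ A.line) (hxB : x ∈ B.line) : ¬ Parallel A B := by
  intro hp
  obtain ⟨r, -, hr⟩ := hp.exists_nonneg_left h.dir_ne_zero
  obtain ⟨s, rfl⟩ := exists_of_mem_line hxA
  obtain ⟨t, ht⟩ := exists_of_mem_line hxB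
  have h1 : turn A.1 A.2 (A.1 + s • A.dir) = 0 := by
    rw [turn_add_smul, wedge_dir_self]; simp
  rw [ht, turn_add_smul, ← hr, wedge_smul_right, wedge_dir_self] at h1
  exact h.left₁ (by simpa using h1)

theorem avoidsPatterns_of_isQuasiParallel {n : ℕ} {W B : Finset Plane} {M : Finset DirSeg}
    (hF : IsBichromatic n W B) (hM : IsBRMatching W B M) (hQ : IsQuasiParallel M) :
    AvoidsPatterns M := by
  obtain ⟨u, -, -, hu, hcross⟩ := hQ
  have hcross' : ∀ A ∈ M, ∀ A' ∈ M, A ≠ A' → ∀ x : Plane, x ∈ A.line → x ∈ A'.line →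
      inner ℝ u x ∉ convexHull ℝ ((fun y : Plane => inner ℝ u y) '' (A.carrier ∪ A'.carrier)) :=
    fun A hA A' hA' hne x hx hx' => hcross A hA A' hA'
      ((IsBRMatching.generic hF hM hA hA' hne).not_parallel_of_mem_lines hx hx') x hx hx'
  have a1 : ∀ A ∈ M, ∀ A' ∈ M, ¬ RayHitsSegment A A' := by
    rintro A hA A' hA' ⟨hne, x, hx, hx'⟩
    exact hcross' A hA A' hA' hne x (mem_line_of_mem_ray hx) (carrier_subset_line hx')
      (subset_convexHull ℝ _ ⟨x, Or.inr hx', rfl⟩)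
  have a2 : ∀ A ∈ M, ∀ A' ∈ M, ¬ OppositeRaysMeet A A' := by
    rintro A hA A' hA' ⟨hne, ⟨x, hx, hx'⟩ | hp⟩
    · apply hcross' A hA A' hA' hne x (mem_line_of_mem_ray (Or.inl hx))
        (mem_line_of_mem_ray (Or.inr hx'))
      -- The projection of `x` lies between the black end of one segment and the white end of
      -- the other.
      have m1 : inner ℝ u A'.2 ∈
          (fun y : Plane => inner ℝ u y) '' (A.carrier ∪ A'.carrier) :=
        ⟨A'.2, Or.inr (right_mem_segment ℝ _ _), rfl⟩
      have m2 : inner ℝ u A.1 ∈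
          (fun y : Plane => inner ℝ u y) '' (A.carrier ∪ A'.carrier) :=
        ⟨A.1, Or.inl (left_mem_segment ℝ _ _), rfl⟩
      refine (convex_convexHull ℝ _).ordConnected.out (subset_convexHull ℝ _ m1)
        (subset_convexHull ℝ _ m2) ⟨?_, ?_⟩
      · obtain ⟨t, ht, rfl⟩ := hx'
        simp only [inner_add_smul]
        nlinarith [hu A' hA']
      · obtain ⟨t, ht, rfl⟩ := hx
        simp only [inner_sub_right, inner_smul_right]
        nlinarith [hu A hA]
    · obtain ⟨r, hr, he⟩ := hp.exists_nonneg_left (IsBRMatching.dir_ne_zero hF hM hA)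
      have := congrArg (fun v : Plane => inner ℝ u v) he
      simp only [inner_smul_right, inner_neg_right] at this
      nlinarith [hu A hA, hu A' hA']
  have hcyc : NoSidedCycle M := by
    intro A hA A' hA' A'' hA'' s1 s2 s3
    have h0 : wedge A'.dir A''.dir • A.dir + wedge A''.dir A.dir • A'.dir +
        wedge A.dir A'.dir • A''.dir = 0 := by
      ext i
      simpa using wedge_relation A.dir A'.dir A''.dir i
    have := congrArg (fun v : Plane => inner ℝ u v) h0
    simp only [inner_add_right, inner_smul_right, inner_zero_right] at this
    have h1 := hu A hA
    have h2 := hu A' hA'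
    have h3 := hu A'' hA''
    rcases cycle_signs s1 s2 s3 with ⟨d1, d2, d3⟩ | ⟨d1, d2, d3⟩
    · nlinarith [mul_pos d2 h1, mul_pos d3 h2, mul_pos d1 h3]
    · nlinarith [mul_neg_of_neg_of_pos d2 h1, mul_neg_of_neg_of_pos d3 h2,
        mul_neg_of_neg_of_pos d1 h3]
  exact (avoidsPatterns_iff hF hM).2 ⟨pairwiseSided_of_avoids hF hM a1 a2, hcyc⟩

/-! ### Linearly ordered matchings are unique -/

/-- Suppose that finitely many objects occupy intervals of columns, that any two objects related by
`rel` share a column, and that `rel` is transitive on triples that share a column. Then some object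
has nothing above it. If `e` has the leftmost right end, then everything related to `e` occupies
the column of that right end, so that `e` can be bypassed or is itself on top. -/
theorem exists_top {α β : Type*} [LinearOrder β] [DecidableEq α] (l r : α → β)
    (rel : α → α → Prop) (hlr : ∀ e, l e ≤ r e) (S : Finset α) (hS : S.Nonempty)
    (hirr : ∀ e ∈ S, ¬ rel e e)
    (hover : ∀ e ∈ S, ∀ f ∈ S, rel e f → ∃ m, l e ≤ m ∧ m ≤ r e ∧ l f ≤ m ∧ m ≤ r f)
    (htrans : ∀ e ∈ S, ∀ f ∈ S, ∀ g ∈ S, ∀ m, l e ≤ m → m ≤ r e → l f ≤ m → m ≤ r f →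
      l g ≤ m → m ≤ r g → rel e f → rel f g → rel e g) :
    ∃ e ∈ S, ∀ f ∈ S, ¬ rel f e := by
  induction S using Finset.strongInduction with
  | H S ih =>
    obtain ⟨e, he, hmin⟩ := S.exists_min_image r hS
    rcases (S.erase e).eq_empty_or_nonempty with h0 | h0
    · refine ⟨e, he, fun f hf => ?_⟩
      have : f = e := by
        by_contra hne
        exact Finset.notMem_empty f (h0 ▸ Finset.mem_erase.2 ⟨hne, hf⟩)
      rw [this]
      exact hirr e he
    · have sub : ∀ {f}, f ∈ S.erase e → f ∈ S := fun h => Finset.mem_of_mem_erase h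
      obtain ⟨t, ht, htop⟩ := ih (S.erase e) (Finset.erase_ssubset he) h0
        (fun f hf => hirr f (sub hf)) (fun f hf g hg => hover f (sub hf) g (sub hg))
        (fun f hf g hg k hk => htrans f (sub hf) g (sub hg) k (sub hk))
      by_cases het : rel e t
      · refine ⟨e, he, fun f hf hfe => ?_⟩
        have hne : f ≠ e := by rintro rfl; exact hirr f hf hfe
        obtain ⟨m, m1, m2, m3, m4⟩ := hover f hf e he hfe
        obtain ⟨k, k1, k2, k3, k4⟩ := hover e he t (sub ht) het
        exact htop f (Finset.mem_erase.2 ⟨hne, hf⟩)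
          (htrans f hf e he t (sub ht) (r e) (m1.trans m4) (hmin f hf) (hlr e) le_rfl
            (k3.trans k2) (hmin t (sub ht)) hfe het)
      · refine ⟨t, sub ht, fun f hf hft => ?_⟩
        by_cases hfe : f = e
        · rw [hfe] at hft; exact het hft
        · exact htop f (Finset.mem_erase.2 ⟨hfe, hf⟩) hft

theorem DirSeg.exists_of_turn_eq_zero {A : DirSeg} (hA : A.dir ≠ 0) {x : Plane}
    (hx : turn A.1 A.2 x = 0) : ∃ t : ℝ, x = A.1 + t • A.dir := by
  have h : wedge A.dir (x - A.1) = 0 := by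
    have := turn_sub_turn A.1 A.2 A.1 x
    rw [hx, turn_left, sub_zero] at this
    exact this.symm
  obtain ⟨t, ht⟩ := exists_smul_of_wedge_eq_zero hA h
  exact ⟨t, by rw [← ht]; abel⟩

/-- Two segments `PP'` and `QQ'` with ends on two lines meet if the order of `P` and `Q` along the
first line differs from the order of `P'` and `Q'` along the second line. The sign conditions say
that the segments are parts of segments that cross both lines in the same sense. -/
theorem exists_mem_of_inconsistent {A A' : DirSeg} (hA' : A'.dir ≠ 0)
    (hAA' : turn A.1 A.2 A'.1 ≠ 0) {P Q P' Q' : Plane} {α β : ℝ} (hα : 0 < α) (hβ : 0 < β)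
    (hP : turn A.1 A.2 P = 0) (hQ : turn A.1 A.2 Q = 0) (hP' : turn A'.1 A'.2 P' = 0)
    (hQ' : turn A'.1 A'.2 Q' = 0) (hPQ : P = Q + α • A.dir) (hPQ' : Q' = P' + β • A'.dir)
    (hX : turn A'.1 A'.2 P * turn A.1 A.2 P' ≤ 0) (hY : turn A'.1 A'.2 Q * turn A.1 A.2 Q' ≤ 0) :
    ∃ x, x ∈ segment ℝ P P' ∧ x ∈ segment ℝ Q Q' := by
  have e1 : turn P P' Q = α * turn A.1 A.2 P' := by
    have : turn P P' Q = α * (turn A.1 A.2 P' - turn A.1 A.2 P) := by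
      rw [hPQ]; simp only [turn, dir, PiLp.add_apply, PiLp.smul_apply, PiLp.sub_apply, smul_eq_mul]
      ring
    rw [this, hP, sub_zero]
  have e2 : turn P P' Q' = β * turn A'.1 A'.2 P := by
    have : turn P P' Q' = -β * (turn A'.1 A'.2 P' - turn A'.1 A'.2 P) := by
      rw [hPQ']; simp only [turn, dir, PiLp.add_apply, PiLp.smul_apply, PiLp.sub_apply, smul_eq_mul]
      ring
    rw [this, hP']; ring
  have e3 : turn Q Q' P = -α * turn A.1 A.2 Q' := by
    have : turn Q Q' P = -α * (turn A.1 A.2 Q' - turn A.1 A.2 Q) := by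
      rw [hPQ]; simp only [turn, dir, PiLp.add_apply, PiLp.smul_apply, PiLp.sub_apply, smul_eq_mul]
      ring
    rw [this, hQ, sub_zero]
  have e4 : turn Q Q' P' = -β * turn A'.1 A'.2 Q := by
    have : turn Q Q' P' = β * (turn A'.1 A'.2 Q' - turn A'.1 A'.2 Q) := by
      rw [hPQ']; simp only [turn, dir, PiLp.add_apply, PiLp.smul_apply, PiLp.sub_apply, smul_eq_mul]
      ring
    rw [this, hQ']; ring
  have hαβ := mul_pos hα hβ
  apply segments_meet
  · rw [e1, e2]; nlinarith
  · rw [e3, e4]; nlinarith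
  · rw [e1, e2]
    intro heq
    have hX' : turn A.1 A.2 P' = 0 := by
      by_contra hne
      have h1 : 0 < α * turn A.1 A.2 P' ^ 2 := by positivity
      have h2 : α * turn A.1 A.2 P' ^ 2 = β * (turn A'.1 A'.2 P * turn A.1 A.2 P') := by
        linear_combination turn A.1 A.2 P' * heq
      linarith [mul_nonpos_of_nonneg_of_nonpos hβ.le hX]
    have hX0 : turn A'.1 A'.2 P = 0 := by
      rw [hX', mul_zero] at heq
      exact (mul_eq_zero.1 heq.symm).resolve_left hβ.ne'
    have f1 : turn A.1 A.2 Q' = β * wedge A.dir A'.dir := by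
      rw [hPQ', turn_add_smul, hX', zero_add]; rfl
    have f2 : turn A'.1 A'.2 Q = α * wedge A.dir A'.dir := by
      have : turn A'.1 A'.2 P = turn A'.1 A'.2 Q + α * wedge A'.dir A.dir := by
        rw [hPQ, turn_add_smul]; rfl
      rw [wedge_swap A.dir] at this
      linarith
    have hw : wedge A.dir A'.dir = 0 := by
      by_contra hne
      have : 0 < (α * β) * wedge A.dir A'.dir ^ 2 := by positivity
      rw [f1, f2] at hY
      nlinarith
    obtain ⟨t, rfl⟩ := exists_of_turn_eq_zero hA' hP'
    rw [turn_add_smul] at hX'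
    apply hAA'
    have : wedge (A.2 - A.1) A'.dir = 0 := hw
    rw [this] at hX'
    linarith

theorem exists_mem_carrier_turn_eq_zero {e : DirSeg} {p q : Plane}
    (h : turn p q e.1 * turn p q e.2 ≤ 0) (hne : turn p q e.1 ≠ turn p q e.2) :
    ∃ x ∈ e.carrier, turn p q x = 0 := by
  have hd : turn p q e.2 - turn p q e.1 ≠ 0 := sub_ne_zero.2 hne.symm
  have hd2 : 0 < (turn p q e.2 - turn p q e.1) ^ 2 := by positivity
  have hq : -turn p q e.1 / (turn p q e.2 - turn p q e.1) =
      (-turn p q e.1 * (turn p q e.2 - turn p q e.1)) / (turn p q e.2 - turn p q e.1) ^ 2 := by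
    field_simp
  refine ⟨e.1 + (-turn p q e.1 / (turn p q e.2 - turn p q e.1)) • e.dir,
    add_smul_dir_mem_carrier e ?_ ?_, ?_⟩
  · rw [hq]
    exact div_nonneg (by nlinarith [sq_nonneg (turn p q e.1)]) hd2.le
  · rw [hq, div_le_one hd2]
    nlinarith [sq_nonneg (turn p q e.2)]
  · have : wedge (q - p) e.dir = turn p q e.2 - turn p q e.1 := (turn_sub_turn _ _ _ _).symm
    rw [turn_add_smul, this]
    field_simp
    ring

/-- A point moving along a segment that crosses two lines in the same sense is on opposite sides of
these lines between the two crossings. -/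
theorem turn_mul_turn_nonpos {e A A' : DirSeg} {P P' : Plane} (hP : P ∈ e.carrier)
    (hP' : P' ∈ e.carrier) (h : turn A.1 A.2 P = 0) (h' : turn A'.1 A'.2 P' = 0)
    (hs : 0 ≤ (turn A.1 A.2 e.2 - turn A.1 A.2 e.1) * (turn A'.1 A'.2 e.2 - turn A'.1 A'.2 e.1)) :
    turn A'.1 A'.2 P * turn A.1 A.2 P' ≤ 0 := by
  obtain ⟨t, -, -, rfl⟩ := exists_of_mem_carrier hP
  obtain ⟨t', -, -, rfl⟩ := exists_of_mem_carrier hP'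
  rw [turn_sub_turn, turn_sub_turn] at hs
  change 0 ≤ wedge (A.2 - A.1) e.dir * wedge (A'.2 - A'.1) e.dir at hs
  rw [turn_add_smul] at h h' ⊢
  rw [turn_add_smul]
  have h1 : turn A.1 A.2 e.1 = -(t * wedge (A.2 - A.1) e.dir) := by linarith
  have h2 : turn A'.1 A'.2 e.1 = -(t' * wedge (A'.2 - A'.1) e.dir) := by linarith
  rw [h1, h2]
  nlinarith [mul_nonneg (sq_nonneg (t - t')) hs]

theorem eq_of_turn_eq_zero_of_mem {e : DirSeg} {p q x y : Plane} (hx : x ∈ e.carrier)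
    (hy : y ∈ e.carrier) (h0 : turn p q x = 0) (h1 : turn p q y = 0)
    (hne : turn p q e.1 ≠ turn p q e.2) : x = y := by
  obtain ⟨t, -, -, rfl⟩ := exists_of_mem_carrier hx
  obtain ⟨s, -, -, rfl⟩ := exists_of_mem_carrier hy
  rw [turn_add_smul] at h0 h1
  have hw : wedge (q - p) e.dir ≠ 0 := by
    have := turn_sub_turn p q e.1 e.2
    intro h
    exact hne (by rw [show e.2 - e.1 = e.dir from rfl, h] at this; linarith)
  have : (t - s) * wedge (q - p) e.dir = 0 := by linarith
  rw [sub_eq_zero.1 ((mul_eq_zero.1 this).resolve_right hw)]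

/-- The segment `e` meets the line `g(A)` above the segment `f`, where "above" refers to the height
`⟪u, x⟫`. -/
def AboveAt (u : Plane) (A e f : DirSeg) : Prop :=
  ∃ P ∈ e.carrier, ∃ Q ∈ f.carrier, turn A.1 A.2 P = 0 ∧ turn A.1 A.2 Q = 0 ∧
    inner ℝ u Q < inner ℝ u P

/-- Two disjoint segments that cross two lines in a consistent way meet both lines in the same
order. -/
theorem AboveAt.transfer {u : Plane} {A A' e f : DirSeg} (hA : 0 < inner ℝ u A.dir)
    (hA' : 0 < inner ℝ u A'.dir) (hAA' : turn A.1 A.2 A'.1 ≠ 0)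
    (hdisj : Disjoint e.carrier f.carrier)
    (he : turn A'.1 A'.2 e.1 * turn A'.1 A'.2 e.2 ≤ 0)
    (hf : turn A'.1 A'.2 f.1 * turn A'.1 A'.2 f.2 ≤ 0)
    (he' : 0 < (turn A.1 A.2 e.2 - turn A.1 A.2 e.1) * (turn A'.1 A'.2 e.2 - turn A'.1 A'.2 e.1))
    (hf' : 0 < (turn A.1 A.2 f.2 - turn A.1 A.2 f.1) * (turn A'.1 A'.2 f.2 - turn A'.1 A'.2 f.1))
    (h : AboveAt u A e f) : AboveAt u A' e f := by
  obtain ⟨P, hP, Q, hQ, tP, tQ, hlt⟩ := h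
  obtain ⟨P', hP', tP'⟩ := exists_mem_carrier_turn_eq_zero he
    (fun h => by rw [h] at he'; simp at he')
  obtain ⟨Q', hQ', tQ'⟩ := exists_mem_carrier_turn_eq_zero hf
    (fun h => by rw [h] at hf'; simp at hf')
  have dA : A.dir ≠ 0 := by rintro h; rw [h] at hA; simp at hA
  have dA' : A'.dir ≠ 0 := by rintro h; rw [h] at hA'; simp at hA'
  refine ⟨P', hP', Q', hQ', tP', tQ', ?_⟩
  by_contra hcon
  obtain ⟨p, hp⟩ := exists_of_turn_eq_zero dA tP
  obtain ⟨q, hq⟩ := exists_of_turn_eq_zero dA tQ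
  obtain ⟨p', hp'⟩ := exists_of_turn_eq_zero dA' tP'
  obtain ⟨q', hq'⟩ := exists_of_turn_eq_zero dA' tQ'
  have hpq : 0 < p - q := by
    rw [hp, hq, inner_add_smul, inner_add_smul] at hlt
    by_contra hc
    nlinarith
  have hpq' : 0 ≤ q' - p' := by
    rw [hp', hq', inner_add_smul, inner_add_smul] at hcon
    by_contra hc
    nlinarith
  rcases hpq'.eq_or_lt with h0 | h0
  · have : P' = Q' := by rw [hp', hq', sub_eq_zero.1 h0.symm]
    exact Set.disjoint_left.1 hdisj hP' (this ▸ hQ')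
  · obtain ⟨x, hx1, hx2⟩ := exists_mem_of_inconsistent (A := A) (A' := A') dA' hAA' hpq h0 tP tQ tP'
      tQ' (by rw [hp, hq]; module) (by rw [hp', hq']; module)
      (turn_mul_turn_nonpos hP hP' tP tP' he'.le) (turn_mul_turn_nonpos hQ hQ' tQ tQ' hf'.le)
    exact Set.disjoint_left.1 hdisj ((convex_segment _ _).segment_subset hP hP' hx1)
      ((convex_segment _ _).segment_subset hQ hQ' hx2)

/-- A linearly ordered matching is the only one: if `e` is a segment of another matching `M'` that
is not in `M`, then the segment of `M'` at the black end of the segment of `M` at the white end of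
`e` passes above `e`, so the segments of `M'` outside `M` have no topmost element. -/
theorem eq_of_isStrictTotalOrder {n : ℕ} {W B : Finset Plane} {M M' : Finset DirSeg}
    (hF : IsBichromatic n W B) (hM : IsBRMatching W B M)
    (hO : IsStrictTotalOrder {A : DirSeg // A ∈ M} (fun A A' => Sided A.1 A'.1))
    (hM' : IsBRMatching W B M') : M' = M := by
  classical
  obtain ⟨u, hu⟩ := exists_inner_dir_pos hF hM hO
  let : LinearOrder {A : DirSeg // A ∈ M} :=
    linearOrderOfSTO (fun A A' : {A : DirSeg // A ∈ M} => Sided A.1 A'.1)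
  have hlt : ∀ {A A' : {A : DirSeg // A ∈ M}}, A < A' → Sided A.1 A'.1 := fun h => h
  have hwhite : ∀ e : {e : DirSeg // e ∈ M'}, ∃ A : {A : DirSeg // A ∈ M}, A.1.1 = e.1.1 := by
    intro e
    obtain ⟨A, ⟨hA, h⟩, -⟩ := hM.white _ (hM'.ends _ e.2).1
    exact ⟨⟨A, hA⟩, h⟩
  have hblack : ∀ e : {e : DirSeg // e ∈ M'}, ∃ A : {A : DirSeg // A ∈ M}, A.1.2 = e.1.2 := by
    intro e
    obtain ⟨A, ⟨hA, h⟩, -⟩ := hM.black _ (hM'.ends _ e.2).2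
    exact ⟨⟨A, hA⟩, h⟩
  choose w hw using hwhite
  choose b hb using hblack
  have hne : ∀ e : {e : DirSeg // e ∈ M'}, e.1 ∉ M → w e ≠ b e := by
    intro e he h
    apply he
    have : (w e).1 = e.1 := Prod.ext (hw e) (by rw [h]; exact hb e)
    rw [← this]; exact (w e).2
  -- The side of `g(m)` on which an end of a segment of `M` lies is given by the order.
  have side : ∀ m X : {A : DirSeg // A ∈ M}, (X ≤ m → 0 ≤ turn m.1.1 m.1.2 X.1.1 ∧
      0 ≤ turn m.1.1 m.1.2 X.1.2) ∧ (m ≤ X → turn m.1.1 m.1.2 X.1.1 ≤ 0 ∧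
      turn m.1.1 m.1.2 X.1.2 ≤ 0) := by
    intro m X
    constructor
    · intro h
      rcases h.eq_or_lt with rfl | h
      · simp
      · exact ⟨(hlt h).2.1.le, (hlt h).2.2.le⟩
    · intro h
      rcases h.eq_or_lt with rfl | h
      · simp
      · exact ⟨(hlt h).1.1.le, (hlt h).1.2.le⟩
  have side' : ∀ m X : {A : DirSeg // A ∈ M}, (X < m → 0 < turn m.1.1 m.1.2 X.1.1 ∧
      0 < turn m.1.1 m.1.2 X.1.2) ∧ (m < X → turn m.1.1 m.1.2 X.1.1 < 0 ∧
      turn m.1.1 m.1.2 X.1.2 < 0) :=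
    fun m X => ⟨fun h => (hlt h).2, fun h => (hlt h).1⟩
  have span : ∀ (e : {e : DirSeg // e ∈ M'}) (m : {A : DirSeg // A ∈ M}), e.1 ∉ M →
      min (w e) (b e) ≤ m → m ≤ max (w e) (b e) →
      turn m.1.1 m.1.2 e.1.1 * turn m.1.1 m.1.2 e.1.2 ≤ 0 ∧
      ((w e < b e ∧ turn m.1.1 m.1.2 e.1.2 - turn m.1.1 m.1.2 e.1.1 < 0) ∨
        (b e < w e ∧ 0 < turn m.1.1 m.1.2 e.1.2 - turn m.1.1 m.1.2 e.1.1)) := by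
    intro e m he h1 h2
    rcases lt_or_gt_of_ne (hne e he) with h | h
    · rw [min_eq_left h.le] at h1
      rw [max_eq_right h.le] at h2
      have s1 := ((side m (w e)).1 h1).1
      have s2 := ((side m (b e)).2 h2).2
      rw [hw] at s1; rw [hb] at s2
      refine ⟨mul_nonpos_of_nonneg_of_nonpos s1 s2, Or.inl ⟨h, ?_⟩⟩
      rcases h1.eq_or_lt with h3 | h3
      · have := ((side' m (b e)).2 (h3 ▸ h)).2
        rw [hb] at this; linarith
      · have := ((side' m (w e)).1 h3).1
        rw [hw] at this; linarith
    · rw [min_eq_right h.le] at h1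
      rw [max_eq_left h.le] at h2
      have s1 := ((side m (b e)).1 h1).2
      have s2 := ((side m (w e)).2 h2).1
      rw [hb] at s1; rw [hw] at s2
      refine ⟨mul_nonpos_of_nonpos_of_nonneg s2 s1, Or.inr ⟨h, ?_⟩⟩
      rcases h1.eq_or_lt with h3 | h3
      · have := ((side' m (w e)).2 (h3 ▸ h)).1
        rw [hw] at this; linarith
      · have := ((side' m (b e)).1 h3).2
        rw [hb] at this; linarith
  have span' : ∀ (e : {e : DirSeg // e ∈ M'}) (m k : {A : DirSeg // A ∈ M}), e.1 ∉ M →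
      min (w e) (b e) ≤ m → m ≤ max (w e) (b e) → min (w e) (b e) ≤ k → k ≤ max (w e) (b e) →
      0 < (turn m.1.1 m.1.2 e.1.2 - turn m.1.1 m.1.2 e.1.1) *
        (turn k.1.1 k.1.2 e.1.2 - turn k.1.1 k.1.2 e.1.1) := by
    intro e m k he h1 h2 h3 h4
    rcases (span e m he h1 h2).2 with ⟨a, c⟩ | ⟨a, c⟩ <;>
      rcases (span e k he h3 h4).2 with ⟨a', c'⟩ | ⟨a', c'⟩
    · exact mul_pos_of_neg_of_neg c c'
    · exact absurd a a'.asymm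
    · exact absurd a a'.asymm
    · exact mul_pos c c'
  have ne_ends : ∀ (e : {e : DirSeg // e ∈ M'}) (m : {A : DirSeg // A ∈ M}), e.1 ∉ M →
      min (w e) (b e) ≤ m → m ≤ max (w e) (b e) →
      turn m.1.1 m.1.2 e.1.1 ≠ turn m.1.1 m.1.2 e.1.2 := by
    intro e m he h1 h2 h
    have := span' e m m he h1 h2 h1 h2
    rw [h] at this
    simp at this
  let rel : {e : DirSeg // e ∈ M'} → {e : DirSeg // e ∈ M'} → Prop := fun e f =>
    e ≠ f ∧ ∃ m : {A : DirSeg // A ∈ M}, min (w e) (b e) ≤ m ∧ m ≤ max (w e) (b e) ∧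
      min (w f) (b f) ≤ m ∧ m ≤ max (w f) (b f) ∧ AboveAt u m.1 e.1 f.1
  have move : ∀ e f : {e : DirSeg // e ∈ M'}, e.1 ∉ M → f.1 ∉ M → rel e f →
      ∀ k, min (w e) (b e) ≤ k → k ≤ max (w e) (b e) → min (w f) (b f) ≤ k →
        k ≤ max (w f) (b f) → AboveAt u k.1 e.1 f.1 := by
    rintro e f he hf ⟨hef, m, m1, m2, m3, m4, hab⟩ k k1 k2 k3 k4
    by_cases hmk : m = k
    · rw [← hmk]; exact hab
    have hmk' : m.1 ≠ k.1 := fun h => hmk (Subtype.ext h)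
    exact hab.transfer (hu _ m.2) (hu _ k.2) (IsBRMatching.generic hF hM m.2 k.2 hmk').left₁
      (hM'.noncrossing _ e.2 _ f.2 fun h => hef (Subtype.ext h)) (span e k he k1 k2).1
      (span f k hf k3 k4).1 (span' e m k he m1 m2 k1 k2) (span' f m k hf m3 m4 k3 k4)
  have hsub : M' ⊆ M := by
    by_contra hcon
    obtain ⟨e₀, he₀, he₀'⟩ := Finset.not_subset.1 hcon
    have memS : ∀ {e : {e : DirSeg // e ∈ M'}},
        e ∈ Finset.univ.filter (fun e : {e : DirSeg // e ∈ M'} => e.1 ∉ M) ↔ e.1 ∉ M := by simp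
    obtain ⟨e, he, htop⟩ := exists_top (fun e => min (w e) (b e)) (fun e => max (w e) (b e)) rel
      (fun e => min_le_max) (Finset.univ.filter fun e : {e : DirSeg // e ∈ M'} => e.1 ∉ M)
      ⟨⟨e₀, he₀⟩, memS.2 he₀'⟩ (fun e _ h => h.1 rfl)
      (fun e _ f _ ⟨_, m, m1, m2, m3, m4, _⟩ => ⟨m, m1, m2, m3, m4⟩)
      (by
        intro e he f hf g hg m e1 e2 f1 f2 g1 g2 hef hfg
        rw [memS] at he hf hg
        obtain ⟨P, hP, Q, hQ, tP, tQ, hlt1⟩ := move e f he hf hef m e1 e2 f1 f2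
        obtain ⟨Q', hQ', R, hR, tQ', tR, hlt2⟩ := move f g hf hg hfg m f1 f2 g1 g2
        obtain rfl := eq_of_turn_eq_zero_of_mem hQ hQ' tQ tQ' (ne_ends f m hf f1 f2)
        have hlt3 : inner ℝ u R < inner ℝ u P := hlt2.trans hlt1
        refine ⟨?_, m, e1, e2, g1, g2, P, hP, R, hR, tP, tR, hlt3⟩
        rintro rfl
        obtain rfl := eq_of_turn_eq_zero_of_mem hP hR tP tR (ne_ends e m he e1 e2)
        exact lt_irrefl _ hlt3)
    rw [memS] at he
    obtain ⟨f, ⟨hf, hfb⟩, -⟩ := hM'.black _ (hM.ends _ (w e).2).2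
    have hfM : f ∉ M := by
      intro hfM
      have h1 : f = (w e).1 := hM.eq_of_snd hfM (w e).2 hfb
      have h2 : f = e.1 := hM'.eq_of_fst hf e.2 (by rw [h1]; exact hw e)
      exact he (h2 ▸ hfM)
    have hbf : b ⟨f, hf⟩ = w e := Subtype.ext (hM.eq_of_snd (b _).2 (w e).2 ((hb _).trans hfb))
    refine htop ⟨f, hf⟩ (memS.2 hfM) ⟨?_, w e, ?_, ?_, min_le_left _ _, le_max_left _ _,
      (w e).1.2, ?_, (w e).1.1, ?_, turn_right _ _, turn_left _ _, ?_⟩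
    · rintro rfl
      exact hne _ he hbf.symm
    · rw [hbf]; exact min_le_right _ _
    · rw [hbf]; exact le_max_right _ _
    · rw [← hfb]; exact right_mem_segment ℝ _ _
    · rw [hw]; exact left_mem_segment ℝ _ _
    · have := hu _ (w e).2
      rw [dir, inner_sub_right] at this
      linarith
  refine hsub.antisymm fun A hA => ?_
  obtain ⟨e, ⟨he, h⟩, -⟩ := hM'.white _ (hM.ends A hA).1
  rw [← hM.eq_of_fst (hsub he) hA h]
  exact he

/-! ### Rematching -/

section Rematch

variable {n : ℕ} {W B : Finset Plane} {M : Finset DirSeg}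

open Classical in
/-- The set of segments that joins the white end of each segment `A` of `M` to the black end of
`σ A`. -/
noncomputable def rematch (M : Finset DirSeg) (σ : Equiv.Perm {A : DirSeg // A ∈ M}) :
    Finset DirSeg :=
  Finset.univ.image fun A : {A : DirSeg // A ∈ M} => ((A.1.1, (σ A).1.2) : DirSeg)

theorem mem_rematch {σ : Equiv.Perm {A : DirSeg // A ∈ M}} {X : DirSeg} :
    X ∈ rematch M σ ↔ ∃ A : {A : DirSeg // A ∈ M}, (A.1.1, (σ A).1.2) = X := by
  simp [rematch]

theorem isBRMatching_rematch (hM : IsBRMatching W B M) {σ : Equiv.Perm {A : DirSeg // A ∈ M}}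
    (hσ : ∀ A A', A ≠ A' →
      Disjoint (segment ℝ A.1.1 (σ A).1.2) (segment ℝ A'.1.1 (σ A').1.2)) :
    IsBRMatching W B (rematch M σ) where
  ends X hX := by
    obtain ⟨A, rfl⟩ := mem_rematch.1 hX
    exact ⟨(hM.ends _ A.2).1, (hM.ends _ (σ A).2).2⟩
  white w hw := by
    obtain ⟨A, ⟨hA, rfl⟩, -⟩ := hM.white w hw
    refine ⟨_, ⟨mem_rematch.2 ⟨⟨A, hA⟩, rfl⟩, rfl⟩, ?_⟩
    rintro X ⟨hX, h⟩
    obtain ⟨A', rfl⟩ := mem_rematch.1 hX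
    obtain rfl : A' = ⟨A, hA⟩ := Subtype.ext (hM.eq_of_fst A'.2 hA h)
    rfl
  black b hb := by
    obtain ⟨A, ⟨hA, rfl⟩, -⟩ := hM.black b hb
    refine ⟨_, ⟨mem_rematch.2 ⟨σ.symm ⟨A, hA⟩, rfl⟩, by simp⟩, ?_⟩
    rintro X ⟨hX, h⟩
    obtain ⟨A', rfl⟩ := mem_rematch.1 hX
    obtain rfl : A' = σ.symm ⟨A, hA⟩ := by
      rw [Equiv.eq_symm_apply]
      exact Subtype.ext (hM.eq_of_snd (σ A').2 hA h)
    rfl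
  noncrossing X hX X' hX' hne := by
    obtain ⟨A, rfl⟩ := mem_rematch.1 hX
    obtain ⟨A', rfl⟩ := mem_rematch.1 hX'
    exact hσ A A' (by rintro rfl; exact hne rfl)

theorem eq_one_of_rematch_eq (hM : IsBRMatching W B M) {σ : Equiv.Perm {A : DirSeg // A ∈ M}}
    (h : rematch M σ = M) : σ = 1 := by
  ext1 A
  have hA : ((A.1.1, (σ A).1.2) : DirSeg) ∈ M := h.subset (mem_rematch.2 ⟨A, rfl⟩)
  have := hM.eq_of_fst hA A.2 rfl
  have hsnd : (σ A).1.2 = A.1.2 := (Prod.ext_iff.1 this).2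
  exact Subtype.ext (hM.eq_of_snd (σ A).2 A.2 hsnd)

/-- The effect of exchanging the black partners of two segments on a sum over the segments. -/
theorem sum_swap_sub [DecidableEq {A : DirSeg // A ∈ M}] (c : Plane → Plane → ℝ)
    (σ : Equiv.Perm {A : DirSeg // A ∈ M}) {A A' : {A : DirSeg // A ∈ M}} (hne : A ≠ A') :
    ∑ X, c X.1.1 ((σ * Equiv.swap A A') X).1.2 - ∑ X, c X.1.1 (σ X).1.2 =
      (c A.1.1 (σ A').1.2 + c A'.1.1 (σ A).1.2) -
        (c A.1.1 (σ A).1.2 + c A'.1.1 (σ A').1.2) := by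
  rw [← Finset.sum_sub_distrib, Fintype.sum_eq_add A A' hne]
  · simp only [Equiv.Perm.mul_apply, Equiv.swap_apply_left, Equiv.swap_apply_right]; ring
  · rintro X ⟨h1, h2⟩
    rw [Equiv.Perm.mul_apply, Equiv.swap_apply_of_ne_of_ne h1 h2, sub_self]

/-- If uncrossing two crossing segments always lowers the total cost, then the cheapest way to join
the white points to the black points is free of crossings. -/
theorem exists_noncrossing_min (hM : IsBRMatching W B M) (c : Plane → Plane → ℝ)
    (hc : ∀ w ∈ W, ∀ w' ∈ W, ∀ b ∈ B, ∀ b' ∈ B, w ≠ w' → b ≠ b' →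
      ¬ Disjoint (segment ℝ w b) (segment ℝ w' b') → c w b' + c w' b < c w b + c w' b') :
    ∃ σ : Equiv.Perm {A : DirSeg // A ∈ M},
      (∀ A A', A ≠ A' →
        Disjoint (segment ℝ A.1.1 (σ A).1.2) (segment ℝ A'.1.1 (σ A').1.2)) ∧
      ∀ τ : Equiv.Perm {A : DirSeg // A ∈ M},
        ∑ X, c X.1.1 (σ X).1.2 ≤ ∑ X, c X.1.1 (τ X).1.2 := by
  classical
  obtain ⟨σ, hσ⟩ := Finite.exists_min
    fun τ : Equiv.Perm {A : DirSeg // A ∈ M} => ∑ X, c X.1.1 (τ X).1.2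
  refine ⟨σ, fun A A' hne => ?_, hσ⟩
  by_contra hcross
  have h1 := hc _ (hM.ends _ A.2).1 _ (hM.ends _ A'.2).1 _ (hM.ends _ (σ A).2).2 _
    (hM.ends _ (σ A').2).2 (fun h => hne (Subtype.ext (hM.eq_of_fst A.2 A'.2 h)))
    (fun h => hne (σ.injective (Subtype.ext (hM.eq_of_snd (σ A).2 (σ A').2 h)))) hcross
  have h2 := hσ (σ * Equiv.swap A A')
  have h3 := sum_swap_sub c σ hne
  linarith

/-- The indicator of the left side of a line. -/
noncomputable def leftIndicator (p q x : Plane) : ℝ :=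
  open Classical in if 0 < turn p q x then 1 else 0

theorem leftIndicator_mono {p q x y : Plane} (h : turn p q x ≤ turn p q y) :
    leftIndicator p q x ≤ leftIndicator p q y := by
  unfold leftIndicator
  split_ifs with h1 h2
  · exact le_rfl
  · exact absurd (h1.trans_le h) h2
  · exact zero_le_one
  · exact le_rfl

/-- The number of crossings with a line is additive along a segment, also if the intermediate point
or an end lies on the line. -/
theorem leftIndicator_add {p q r s x : Plane} (hx : x ∈ segment ℝ r s) :
    |leftIndicator p q r - leftIndicator p q x| + |leftIndicator p q x - leftIndicator p q s| =
      |leftIndicator p q r - leftIndicator p q s| := by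
  obtain ⟨a, b, ha, hb, hab, rfl⟩ := hx
  have hx := turn_combo p q r s hab
  have hb' : b = 1 - a := by linarith
  rcases le_total (turn p q r) (turn p q s) with h | h
  · have h1 : turn p q r ≤ turn p q (a • r + b • s) := by rw [hx, hb']; rw [hb'] at hb; nlinarith
    have h2 : turn p q (a • r + b • s) ≤ turn p q s := by rw [hx, hb']; nlinarith
    have m1 := leftIndicator_mono h1
    have m2 := leftIndicator_mono h2
    rw [abs_of_nonpos (by linarith), abs_of_nonpos (by linarith), abs_of_nonpos (by linarith)]
    ring
  · have h1 : turn p q (a • r + b • s) ≤ turn p q r := by rw [hx, hb']; rw [hb'] at hb; nlinarith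
    have h2 : turn p q s ≤ turn p q (a • r + b • s) := by rw [hx, hb']; nlinarith
    have m1 := leftIndicator_mono h1
    have m2 := leftIndicator_mono h2
    rw [abs_of_nonneg (by linarith), abs_of_nonneg (by linarith), abs_of_nonneg (by linarith)]
    ring

/-- Uncrossing two segments strictly lowers the total length. -/
theorem dist_uncross (hF : IsBichromatic n W B) {w w' b b' : Plane} (hw : w ∈ W) (hw' : w' ∈ W)
    (hb : b ∈ B) (hb' : b' ∈ B) (hww : w ≠ w') (hbb : b ≠ b') {x : Plane}
    (hx : x ∈ segment ℝ w b) (hx' : x ∈ segment ℝ w' b') :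
    dist w b' + dist w' b < dist w b + dist w' b' := by
  have hwb : w ≠ b := Finset.disjoint_iff_ne.1 hF.disj _ hw _ hb
  have hwb' : w ≠ b' := Finset.disjoint_iff_ne.1 hF.disj _ hw _ hb'
  have hw'b' : w' ≠ b' := Finset.disjoint_iff_ne.1 hF.disj _ hw' _ hb'
  have e1 := dist_add_dist_of_mem_segment hx
  have e2 := dist_add_dist_of_mem_segment hx'
  have t1 : dist w b' ≤ dist w x + dist x b' := dist_triangle _ _ _
  have t2 := dist_triangle w' x b
  have t3 : dist w b' ≠ dist w x + dist x b' := by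
    intro h
    have hxs : x ∈ segment ℝ w b' := mem_segment_iff_wbtw.2 (dist_add_dist_eq_iff.1 h.symm)
    obtain ⟨t, -, -, ht⟩ := segment_combo hx
    obtain ⟨s, -, -, hs⟩ := segment_combo hxs
    -- The line through `w` and `b` contains `x`, so `x` is `w` unless `b'` is on that line.
    have h1 : turn w b x = 0 := by
      rw [ht, turn_add_smul, turn_left]; simp only [wedge, PiLp.sub_apply]; ring
    have h2 : turn w b x = s * turn w b b' := by
      rw [hs, turn_add_smul, turn_left, ← turn_sub_turn, turn_left]; ring
    have h3 : turn w b b' ≠ 0 := hF.turn_ne_zero (Or.inl hw) (Or.inr hb) (Or.inr hb') hwb hwb' hbb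
    have hs0 : s = 0 := by
      rw [h1] at h2
      exact (mul_eq_zero.1 h2.symm).resolve_right h3
    rw [hs0, zero_smul, add_zero] at hs
    rw [hs] at hx'
    obtain ⟨r, -, -, hr⟩ := segment_combo hx'
    apply hF.turn_ne_zero (Or.inl hw') (Or.inr hb') (Or.inl hw) hw'b' hww.symm hwb'.symm
    rw [hr, turn_add_smul, turn_left]; simp only [wedge, PiLp.sub_apply]; ring
  have := lt_of_le_of_ne t1 t3
  linarith

/-- If a matching is unique, then its segments are pairwise comparable. A pair that is not
comparable has a chromatic cut, and exchanging its black ends reduces the number of crossings with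
the cut. The crossing-free rematching that minimizes this number plus a small multiple of the length
is therefore a different one. -/
theorem pairwiseSided_of_unique (hF : IsBichromatic n W B) (hM : IsBRMatching W B M)
    (huniq : ∀ M' : Finset DirSeg, IsBRMatching W B M' → M' = M) : PairwiseSided M := by
  classical
  intro A hA A' hA' hne
  by_contra hcon
  push Not at hcon
  obtain ⟨p, q, h1, h2, h3⟩ :=
    (IsBRMatching.generic hF hM hA hA' hne).exists_cut hcon.1 hcon.2
  set K := dist A.1 A'.2 + dist A'.1 A.2 with hK
  have hK0 : 0 ≤ K := by positivity
  set ε := 1 / (1 + K) with hε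
  have hε0 : 0 < ε := by positivity
  set c : Plane → Plane → ℝ := fun x y =>
    |leftIndicator p q x - leftIndicator p q y| + ε * dist x y with hc
  obtain ⟨σ, hσ, hmin⟩ := exists_noncrossing_min hM c (by
    intro w hw w' hw' b hb b' hb' hww hbb hcross
    obtain ⟨x, hx, hx'⟩ := Set.not_disjoint_iff.1 hcross
    have d := mul_lt_mul_of_pos_left (dist_uncross hF hw hw' hb hb' hww hbb hx hx') hε0
    have s1 := leftIndicator_add (p := p) (q := q) hx
    have s2 := leftIndicator_add (p := p) (q := q) hx'
    have t1 := abs_sub_le (leftIndicator p q w) (leftIndicator p q x) (leftIndicator p q b')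
    have t2 := abs_sub_le (leftIndicator p q w') (leftIndicator p q x) (leftIndicator p q b)
    simp only [hc]
    linarith)
  have hone := eq_one_of_rematch_eq hM (huniq _ (isBRMatching_rematch hM hσ))
  subst hone
  have hne' : (⟨A, hA⟩ : {A : DirSeg // A ∈ M}) ≠ ⟨A', hA'⟩ := fun h => hne (congrArg Subtype.val h)
  have m1 := hmin (1 * Equiv.swap ⟨A, hA⟩ ⟨A', hA'⟩)
  have m2 := sum_swap_sub c 1 hne'
  have hcost : c A.1 A.2 + c A'.1 A'.2 ≤ c A.1 A'.2 + c A'.1 A.2 := by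
    simp only [Equiv.Perm.one_apply] at m1 m2
    linarith
  have ind1 : ∀ {x}, 0 < turn p q x → leftIndicator p q x = 1 := fun h => if_pos h
  have ind0 : ∀ {x}, turn p q x < 0 → leftIndicator p q x = 0 := fun h => if_neg h.not_gt
  have hεK : ε * K < 1 := by
    rw [hε, div_mul_eq_mul_div, one_mul, div_lt_one (by linarith)]; linarith
  have d1 : 0 ≤ ε * dist A.1 A.2 := by positivity
  have d2 : 0 ≤ ε * dist A'.1 A'.2 := by positivity
  have d3 : ε * dist A.1 A'.2 + ε * dist A'.1 A.2 < 1 := by rw [← mul_add]; exact hεK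
  simp only [hc] at hcost
  unfold CrossedBy PtLeft PtRight at h1 h2
  rcases h1 with ⟨a1, a2⟩ | ⟨a1, a2⟩ <;> rcases h2 with ⟨b1, b2⟩ | ⟨b1, b2⟩
  · nlinarith
  · rw [ind1 a1, ind0 a2, ind0 b1, ind1 b2] at hcost
    norm_num at hcost
    linarith
  · rw [ind0 a1, ind1 a2, ind1 b1, ind0 b2] at hcost
    norm_num at hcost
    linarith
  · nlinarith

/-- A segment is not to the right of all three segments of a cycle. -/
theorem not_sink_of_cycle {A B C D : DirSeg} (hBA : Sided B A) (hCA : Sided C A)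
    (hDA : Sided D A) (hBC : Sided B C) (hCD : Sided C D) (hDB : Sided D B) : False :=
  not_source_of_cycle hBA.swap hDA.swap hCA.swap hDB.swap hCD.swap hBC.swap

/-- In a matching with pairwise comparable segments and a cycle, every segment has an immediate
successor: the first one among the segments on its right, which are linearly ordered. -/
theorem exists_next (hP : PairwiseSided M) (hC : ¬ NoSidedCycle M) {A : DirSeg} (hA : A ∈ M) :
    ∃ X ∈ M, Sided A X ∧ ∀ Y ∈ M, Sided A Y → Y ≠ X → Sided X Y := by
  classical
  have hne : (M.filter fun X => Sided A X).Nonempty := by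
    by_contra hcon
    rw [Finset.not_nonempty_iff_eq_empty, Finset.filter_eq_empty_iff] at hcon
    unfold NoSidedCycle at hC
    push Not at hC
    obtain ⟨X, hX, Y, hY, Z, hZ, h1, h2, h3⟩ := hC
    have before : ∀ S ∈ M, ∀ T ∈ M, Sided S T → Sided S A := fun S hS T hT hST =>
      (hP A hA S hS (by rintro rfl; exact hcon hT hST)).resolve_left (hcon hS)
    exact not_sink_of_cycle (before X hX Y hY h1) (before Y hY Z hZ h2) (before Z hZ X hX h3)
      h1 h2 h3
  obtain ⟨X, hX, hmin⟩ := Finset.exists_min_image _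
    (fun X => (M.filter fun Y => Sided A Y ∧ Sided Y X).card) hne
  rw [Finset.mem_filter] at hX
  refine ⟨X, hX.1, hX.2, fun Y hY hAY hYX => ?_⟩
  by_contra hcon
  have hYX' : Sided Y X := (hP Y hY X hX.1 hYX).resolve_right hcon
  refine (hmin Y (Finset.mem_filter.2 ⟨hY, hAY⟩)).not_gt (Finset.card_lt_card ?_)
  rw [Finset.ssubset_iff_of_subset]
  · exact ⟨Y, Finset.mem_filter.2 ⟨hY, hAY, hYX'⟩,
      fun h => (Finset.mem_filter.1 h).2.2.ne rfl⟩
  · intro Z hZ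
    rw [Finset.mem_filter] at hZ ⊢
    obtain ⟨hZM, hAZ, hZY⟩ := hZ
    refine ⟨hZM, hAZ, (hP Z hZM X hX.1 ?_).resolve_right fun hXZ => ?_⟩
    · rintro rfl; exact hYX'.asymm hZY
    · exact not_source_of_cycle hAZ hAY hX.2 hZY hYX' hXZ

/-- Joining white ends to black ends of immediate successors creates no crossing, because
the line through the later one of the two segments separates the two new segments. -/
theorem disjoint_of_next {A A' X Y : DirSeg} (hAA' : Sided A A') (hX : X = A' ∨ Sided X A')
    (hY : Sided A' Y) (hne : A'.1 ≠ X.2) : Disjoint (segment ℝ A.1 X.2) (segment ℝ A'.1 Y.2) := by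
  rw [Set.disjoint_left]
  rintro x ⟨a, b, ha, hb, hab, rfl⟩ ⟨c, d, hc, hd, hcd, hx⟩
  have h1 := turn_combo A'.1 A'.2 A.1 X.2 hab
  have h2 := turn_combo A'.1 A'.2 A'.1 Y.2 hcd
  rw [hx, h1, turn_left] at h2
  have k1 : 0 < turn A'.1 A'.2 A.1 := hAA'.2.1
  have k2 : 0 ≤ turn A'.1 A'.2 X.2 := by
    rcases hX with rfl | h
    · simp
    · exact h.2.2.le
  have k3 : turn A'.1 A'.2 Y.2 < 0 := hY.1.2
  have l1 := mul_nonneg ha k1.le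
  have l2 := mul_nonneg hb k2
  have l3 := mul_nonneg hd (neg_nonneg.2 k3.le)
  have a0 : a = 0 :=
    (mul_eq_zero.1 (show a * turn A'.1 A'.2 A.1 = 0 by linarith)).resolve_right k1.ne'
  have d0 : d = 0 :=
    (mul_eq_zero.1 (show d * turn A'.1 A'.2 Y.2 = 0 by linarith)).resolve_right k3.ne
  rw [a0, zero_add] at hab
  rw [d0, add_zero] at hcd
  rw [a0, d0, hab, hcd] at hx
  exact hne (by simpa using hx)

/-- A unique matching has no cycle, since a cycle allows to rotate the matching, joining each white
end to the black end of the immediate successor. -/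
theorem noSidedCycle_of_unique (hF : IsBichromatic n W B) (hM : IsBRMatching W B M)
    (huniq : ∀ M' : Finset DirSeg, IsBRMatching W B M' → M' = M) (hP : PairwiseSided M) :
    NoSidedCycle M := by
  by_contra hC
  have hnext : ∀ A : {A : DirSeg // A ∈ M}, ∃ X : {A : DirSeg // A ∈ M}, Sided A.1 X.1 ∧
      ∀ Y ∈ M, Sided A.1 Y → Y ≠ X.1 → Sided X.1 Y := by
    intro A
    obtain ⟨X, hX, h⟩ := exists_next hP hC A.2
    exact ⟨⟨X, hX⟩, h⟩
  choose next hn1 hn2 using hnext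
  have hinj : Function.Injective next := by
    intro A A' h
    by_contra hne
    have key : ∀ S T : {A : DirSeg // A ∈ M}, next S = next T → ¬ Sided S.1 T.1 := by
      intro S T hST hs
      have h1 := hn1 T
      have h2 := hn2 S T.1 T.2 hs (by rw [hST]; exact h1.ne)
      rw [hST] at h2
      exact h1.asymm h2
    exact (hP _ A.2 _ A'.2 fun h' => hne (Subtype.ext h')).elim (key _ _ h) (key _ _ h.symm)
  let σ : Equiv.Perm {A : DirSeg // A ∈ M} :=
    Equiv.ofBijective next (Finite.injective_iff_bijective.1 hinj)
  have hsep : ∀ A A' : {A : DirSeg // A ∈ M}, Sided A.1 A'.1 →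
      Disjoint (segment ℝ A.1.1 (σ A).1.2) (segment ℝ A'.1.1 (σ A').1.2) := by
    intro A A' h
    refine disjoint_of_next h ?_ (hn1 A') (IsBRMatching.fst_ne_snd hF hM A'.2 (σ A).2)
    by_cases hX : A'.1 = (next A).1
    · exact Or.inl hX.symm
    · exact Or.inr (hn2 A A'.1 A'.2 h hX)
  have hone := eq_one_of_rematch_eq hM (huniq _ (isBRMatching_rematch hM (σ := σ) (by
    intro A A' hne
    rcases hP _ A.2 _ A'.2 fun h => hne (Subtype.ext h) with h | h
    · exact hsep A A' h
    · exact (hsep A' A h).symm)))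
  unfold NoSidedCycle at hC
  push Not at hC
  obtain ⟨X, hX, -⟩ := hC
  have : next ⟨X, hX⟩ = ⟨X, hX⟩ := congrArg (fun τ : Equiv.Perm _ => τ ⟨X, hX⟩) hone
  exact (hn1 ⟨X, hX⟩).ne (congrArg Subtype.val this.symm)

end Rematch

/-! ### The boundary of the convex hull of a finite planar set -/

/-- Some nonzero linear functional attains its maximum over `F` at `p`. -/
def Supported (F : Set Plane) (p : Plane) : Prop :=
  ∃ a b : ℝ, (a ≠ 0 ∨ b ≠ 0) ∧ ∀ y ∈ F, a * y 0 + b * y 1 ≤ a * p 0 + b * p 1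

theorem linear_eq_coords (f : Plane →ₗ[ℝ] ℝ) (y : Plane) :
    f y = f (EuclideanSpace.single 0 1) * y 0 + f (EuclideanSpace.single 1 1) * y 1 := by
  have : y = y 0 • EuclideanSpace.single (0 : Fin 2) (1 : ℝ) +
      y 1 • EuclideanSpace.single (1 : Fin 2) (1 : ℝ) := by
    apply plane_ext <;> simp
  conv_lhs => rw [this]
  simp only [map_add, map_smul, smul_eq_mul]
  ring

theorem coords_ne_zero {f : Plane →ₗ[ℝ] ℝ} (hf : f ≠ 0) :
    f (EuclideanSpace.single 0 1) ≠ 0 ∨ f (EuclideanSpace.single 1 1) ≠ 0 := by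
  by_contra hcon
  push Not at hcon
  apply hf
  ext y
  rw [linear_eq_coords, hcon.1, hcon.2]
  simp

theorem supported_of_mem_frontier {F : Set Plane} (hne : F.Nonempty) {x : Plane}
    (hx : x ∈ convexHull ℝ F) (hfr : x ∈ frontier (convexHull ℝ F)) : Supported F x := by
  have hsub := subset_convexHull ℝ F
  by_cases hint : (interior (convexHull ℝ F)).Nonempty
  · obtain ⟨f, hf, hmax⟩ := geometric_hahn_banach_of_nonempty_interior_point
      (convex_convexHull ℝ F) hfr.2 hint
    have hf' : (f : Plane →ₗ[ℝ] ℝ) ≠ 0 := fun h => hf (by ext y; exact LinearMap.congr_fun h y)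
    refine ⟨_, _, coords_ne_zero hf', fun y hy => ?_⟩
    rw [← linear_eq_coords, ← linear_eq_coords]
    exact hmax y (hsub hy)
  · rw [interior_convexHull_nonempty_iff_affineSpan_eq_top] at hint
    have hne' : ((affineSpan ℝ F : AffineSubspace ℝ Plane) : Set Plane).Nonempty :=
      hne.mono (subset_affineSpan ℝ F)
    rw [← AffineSubspace.direction_eq_top_iff_of_nonempty hne'] at hint
    obtain ⟨f, hf, hker⟩ := Submodule.exists_le_ker_of_lt_top _ (lt_top_iff_ne_top.2 hint)
    refine ⟨_, _, coords_ne_zero hf, fun y hy => ?_⟩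
    rw [← linear_eq_coords, ← linear_eq_coords]
    have hx' : x ∈ affineSpan ℝ F := convexHull_subset_affineSpan F hx
    have hd := hker (AffineSubspace.vsub_mem_direction (subset_affineSpan ℝ F hy) hx')
    rw [LinearMap.mem_ker, vsub_eq_sub, map_sub] at hd
    linarith

theorem mem_frontier_of_supported {F : Set Plane} {x : Plane} (hx : x ∈ convexHull ℝ F)
    (hs : Supported F x) : x ∈ frontier (convexHull ℝ F) := by
  refine ⟨subset_closure hx, fun hint => ?_⟩
  obtain ⟨a, b, hab, hmax⟩ := hs
  have hle : ∀ y ∈ convexHull ℝ F, a * y 0 + b * y 1 ≤ a * x 0 + b * x 1 := by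
    have hconv : Convex ℝ {y : Plane | a * y 0 + b * y 1 ≤ a * x 0 + b * x 1} := by
      intro y hy z hz s t hs ht hst
      simp only [Set.mem_ofPred_eq, PiLp.add_apply, PiLp.smul_apply, smul_eq_mul] at hy hz ⊢
      obtain rfl : t = 1 - s := by linarith
      nlinarith [mul_le_mul_of_nonneg_left hy hs, mul_le_mul_of_nonneg_left hz ht]
    exact fun y hy => convexHull_min hmax hconv hy
  -- Moving from `x` in the direction of the functional leaves the hull.
  set v : Plane := !₂[a, b] with hv
  have hcont : Filter.Tendsto (fun t : ℝ => x + t • v) (nhds 0) (nhds x) := by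
    have : Continuous fun t : ℝ => x + t • v := by fun_prop
    simpa using this.tendsto 0
  have hev : ∀ᶠ t in nhdsWithin (0 : ℝ) (Set.Ioi 0), x + t • v ∈ convexHull ℝ F :=
    (hcont.mono_left nhdsWithin_le_nhds) (mem_interior_iff_mem_nhds.1 hint)
  obtain ⟨t, ht, ht0⟩ := (hev.and self_mem_nhdsWithin).exists
  have := hle _ ht
  simp only [hv, PiLp.add_apply, PiLp.smul_apply, smul_eq_mul] at this
  have ht0' : 0 < t := ht0
  have hpos : 0 < a ^ 2 + b ^ 2 := by
    rcases hab with h | h <;> positivity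
  simp at this
  nlinarith [mul_pos ht0' hpos]

theorem supported_of_turn_le {F : Set Plane} {p q c : Plane} (hpq : p ≠ q)
    (h : ∀ y ∈ F, turn p q y ≤ turn p q c) : Supported F c := by
  refine ⟨-(q 1 - p 1), q 0 - p 0, ?_, fun y hy => ?_⟩
  · by_contra hcon
    push Not at hcon
    exact hpq (plane_ext (by linarith) (by linarith))
  · have := h y hy
    unfold turn at this
    linarith

/-- A supported point is not inside a triangle spanned by points of the set. -/
theorem Supported.false_of_triangle {F : Set Plane} {x y₁ y₂ y₃ : Plane} (hx : Supported F x)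
    (h₁ : y₁ ∈ F) (h₂ : y₂ ∈ F) (h₃ : y₃ ∈ F) (h₁₂ : 0 < turn y₁ y₂ x) (h₂₃ : 0 < turn y₂ y₃ x)
    (h₃₁ : 0 < turn y₃ y₁ x) : False := by
  obtain ⟨a, b, hab, hmax⟩ := hx
  have m₁ := hmax _ h₁
  have m₂ := hmax _ h₂
  have m₃ := hmax _ h₃
  set φ₁ := a * (y₁ 0 - x 0) + b * (y₁ 1 - x 1) with e₁
  set φ₂ := a * (y₂ 0 - x 0) + b * (y₂ 1 - x 1) with e₂
  set φ₃ := a * (y₃ 0 - x 0) + b * (y₃ 1 - x 1) with e₃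
  have n₁ : φ₁ ≤ 0 := by rw [e₁]; linarith
  have n₂ : φ₂ ≤ 0 := by rw [e₂]; linarith
  have n₃ : φ₃ ≤ 0 := by rw [e₃]; linarith
  have hsum : turn y₂ y₃ x * φ₁ + turn y₃ y₁ x * φ₂ + turn y₁ y₂ x * φ₃ = 0 := by
    rw [e₁, e₂, e₃]; unfold turn; ring
  have k₁ := mul_nonneg h₂₃.le (neg_nonneg.2 n₁)
  have k₂ := mul_nonneg h₃₁.le (neg_nonneg.2 n₂)
  have k₃ := mul_nonneg h₁₂.le (neg_nonneg.2 n₃)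
  have z₁ : φ₁ = 0 :=
    (mul_eq_zero.1 (show turn y₂ y₃ x * φ₁ = 0 by linarith)).resolve_left h₂₃.ne'
  have z₂ : φ₂ = 0 :=
    (mul_eq_zero.1 (show turn y₃ y₁ x * φ₂ = 0 by linarith)).resolve_left h₃₁.ne'
  have ha : a * turn y₁ y₂ x = 0 := by
    have : a * turn y₁ y₂ x = φ₁ * (y₂ 1 - x 1) - φ₂ * (y₁ 1 - x 1) := by
      rw [e₁, e₂]; unfold turn; ring
    rw [this, z₁, z₂]; ring
  have hb : b * turn y₁ y₂ x = 0 := by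
    have : b * turn y₁ y₂ x = φ₂ * (y₁ 0 - x 0) - φ₁ * (y₂ 0 - x 0) := by
      rw [e₁, e₂]; unfold turn; ring
    rw [this, z₁, z₂]; ring
  rcases hab with h | h
  · exact h ((mul_eq_zero.1 ha).resolve_right h₁₂.ne')
  · exact h ((mul_eq_zero.1 hb).resolve_right h₁₂.ne')

/-- The segment from `p` to `q` lies in the boundary of the convex hull. -/
def HullEdge (F : Set Plane) (p q : Plane) : Prop :=
  segment ℝ p q ⊆ frontier (convexHull ℝ F)

theorem HullEdge.symm {F : Set Plane} {p q : Plane} (h : HullEdge F p q) : HullEdge F q p := by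
  unfold HullEdge; rw [segment_symm]; exact h

theorem hullEdge_of_turn_nonpos {F : Set Plane} {p q : Plane} (hp : p ∈ F) (hq : q ∈ F)
    (hpq : p ≠ q) (h : ∀ y ∈ F, turn p q y ≤ 0) : HullEdge F p q := by
  intro x hx
  refine mem_frontier_of_supported (segment_subset_convexHull hp hq hx)
    (supported_of_turn_le hpq fun y hy => (h y hy).trans_eq ?_)
  obtain ⟨a, b, -, -, hab, rfl⟩ := hx
  rw [turn_combo _ _ _ _ hab]
  simp

/-- No three points of the set are on a line. -/
def GeneralPosition (F : Set Plane) : Prop :=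
  ∀ p ∈ F, ∀ q ∈ F, ∀ r ∈ F, p ≠ q → p ≠ r → q ≠ r → turn p q r ≠ 0

theorem HullEdge.one_side {F : Set Plane} (hgp : GeneralPosition F) {p q : Plane} (hp : p ∈ F)
    (hq : q ∈ F) (hpq : p ≠ q) (h : HullEdge F p q) :
    (∀ y ∈ F, y ≠ p → y ≠ q → turn p q y < 0) ∨ (∀ y ∈ F, y ≠ p → y ≠ q → 0 < turn p q y) := by
  have hmid : (1 / 2 : ℝ) • p + (1 / 2 : ℝ) • q ∈ segment ℝ p q :=
    ⟨1 / 2, 1 / 2, by norm_num, by norm_num, by norm_num, rfl⟩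
  obtain ⟨a, b, hab, hmax⟩ := supported_of_mem_frontier ⟨p, hp⟩
    (segment_subset_convexHull hp hq hmid) (h hmid)
  simp only [PiLp.add_apply, PiLp.smul_apply, smul_eq_mul] at hmax
  have m1 := hmax p hp
  have m2 := hmax q hq
  have horth : a * (q 0 - p 0) + b * (q 1 - p 1) = 0 := by linarith
  have hpos : 0 < a ^ 2 + b ^ 2 := by rcases hab with h | h <;> positivity
  -- The functional is proportional to the equation of the line `pq`.
  have key : ∀ y, (a ^ 2 + b ^ 2) * turn p q y = (b * (q 0 - p 0) - a * (q 1 - p 1)) *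
      (a * (y 0 - p 0) + b * (y 1 - p 1)) := by
    intro y
    unfold turn
    linear_combination -(b * (y 0 - p 0) - a * (y 1 - p 1)) * horth
  have hφ : ∀ y ∈ F, a * (y 0 - p 0) + b * (y 1 - p 1) ≤ 0 := by
    intro y hy
    have := hmax y hy
    linarith
  rcases le_total 0 (b * (q 0 - p 0) - a * (q 1 - p 1)) with hκ | hκ
  · left
    intro y hy hyp hyq
    refine lt_of_le_of_ne ?_ (hgp p hp q hq y hy hpq hyp.symm hyq.symm)
    by_contra hcon
    nlinarith [key y, mul_nonneg hκ (neg_nonneg.2 (hφ y hy)), mul_pos hpos (not_le.1 hcon)]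
  · right
    intro y hy hyp hyq
    refine lt_of_le_of_ne ?_ (hgp p hp q hq y hy hpq hyp.symm hyq.symm).symm
    by_contra hcon
    nlinarith [key y, mul_nonneg (neg_nonneg.2 hκ) (neg_nonneg.2 (hφ y hy)),
      mul_pos hpos (neg_pos.2 (not_le.1 hcon))]

/-- A step along the boundary of the convex hull between two points with the property `S`. -/
def HullStep (F : Set Plane) (S : Plane → Prop) (x y : Plane) : Prop :=
  x ≠ y ∧ x ∈ F ∧ y ∈ F ∧ HullEdge F x y ∧ S x ∧ S y

/-- Two points `p` and `q` of the set on the boundary of its convex hull are joined by a chain of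
hull edges that uses, apart from `p` and `q`, only points strictly to the left of the line `pq`. -/
theorem exists_hullChain {F : Set Plane} (hfin : F.Finite) (hgp : GeneralPosition F)
    (S : Plane → Prop) {p q : Plane} (hp : p ∈ F) (hq : q ∈ F) (hpq : p ≠ q)
    (hsp : Supported F p) (hsq : Supported F q)
    (hS : ∀ x ∈ F, Supported F x → x = p ∨ x = q ∨ 0 < turn p q x → S x) :
    Relation.ReflTransGen (HullStep F S) p q := by
  induction hk : {y ∈ F | 0 < turn p q y}.ncard using Nat.strong_induction_on
    generalizing p q with
  | _ k ih =>
    by_cases hemp : ∀ y ∈ F, turn p q y ≤ 0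
    · exact Relation.ReflTransGen.single ⟨hpq, hp, hq, hullEdge_of_turn_nonpos hp hq hpq hemp,
        hS p hp hsp (Or.inl rfl), hS q hq hsq (Or.inr (Or.inl rfl))⟩
    obtain ⟨c, hc, hmax⟩ := Set.exists_max_image F (turn p q) hfin ⟨p, hp⟩
    have hcpos : 0 < turn p q c := by
      push Not at hemp
      obtain ⟨y, hy, hy0⟩ := hemp
      exact hy0.trans_le (hmax y hy)
    have hsc : Supported F c := supported_of_turn_le hpq hmax
    have hcp : c ≠ p := by rintro rfl; simp at hcpos
    have hcq : c ≠ q := by rintro rfl; simp at hcpos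
    have left₁ : ∀ y ∈ F, 0 < turn p c y → 0 < turn p q y := by
      intro y hy h
      by_contra hcon
      have hyp : y ≠ p := by rintro rfl; simp at h
      have hyq : y ≠ q := by rintro rfl; rw [turn_swap_right] at h; linarith
      have hneg : turn p q y < 0 :=
        lt_of_le_of_ne (not_lt.1 hcon) (hgp p hp q hq y hy hpq hyp.symm hyq.symm)
      refine hsp.false_of_triangle hq hc hy ?_ ?_ ?_
      · rwa [← turn_rotate]
      · rwa [← turn_rotate]
      · rw [← turn_rotate, turn_swap_right]; linarith
    have left₂ : ∀ y ∈ F, 0 < turn c q y → 0 < turn p q y := by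
      intro y hy h
      by_contra hcon
      have hyp : y ≠ p := by
        rintro rfl
        rw [← turn_rotate, turn_swap_right] at h; linarith
      have hyq : y ≠ q := by rintro rfl; simp at h
      have hneg : turn p q y < 0 :=
        lt_of_le_of_ne (not_lt.1 hcon) (hgp p hp q hq y hy hpq hyp.symm hyq.symm)
      refine hsq.false_of_triangle hc hp hy ?_ ?_ ?_
      · rwa [turn_rotate]
      · rw [turn_swap_right]; linarith
      · rwa [turn_rotate]
    have card₁ : {y ∈ F | 0 < turn p c y}.ncard < k := by
      rw [← hk]
      refine Set.ncard_lt_ncard ⟨fun y hy => ⟨hy.1, left₁ y hy.1 hy.2⟩, fun hsub => ?_⟩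
        (hfin.subset fun y hy => hy.1)
      have := (hsub (show c ∈ {y ∈ F | 0 < turn p q y} from ⟨hc, hcpos⟩)).2
      simp at this
    have card₂ : {y ∈ F | 0 < turn c q y}.ncard < k := by
      rw [← hk]
      refine Set.ncard_lt_ncard ⟨fun y hy => ⟨hy.1, left₂ y hy.1 hy.2⟩, fun hsub => ?_⟩
        (hfin.subset fun y hy => hy.1)
      have := (hsub (show c ∈ {y ∈ F | 0 < turn p q y} from ⟨hc, hcpos⟩)).2
      simp at this
    have chain₁ := ih _ card₁ hp hc hcp.symm hsp hsc (by
      rintro x hx hsx (rfl | rfl | h)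
      · exact hS _ hx hsx (Or.inl rfl)
      · exact hS _ hx hsx (Or.inr (Or.inr hcpos))
      · exact hS x hx hsx (Or.inr (Or.inr (left₁ x hx h)))) rfl
    have chain₂ := ih _ card₂ hc hq hcq hsc hsq (by
      rintro x hx hsx (rfl | rfl | h)
      · exact hS _ hx hsx (Or.inr (Or.inr hcpos))
      · exact hS _ hx hsx (Or.inr (Or.inl rfl))
      · exact hS x hx hsx (Or.inr (Or.inr (left₂ x hx h)))) rfl
    exact chain₁.trans chain₂

/-! ### Color intervals -/

section ColorIntervals

variable {n : ℕ} {W B : Finset Plane} {M : Finset DirSeg}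

theorem IsBichromatic.generalPosition (hF : IsBichromatic n W B) :
    GeneralPosition (W ∪ B : Set Plane) :=
  fun _ hp _ hq _ hr => hF.turn_ne_zero hp hq hr

theorem finite_union (W B : Finset Plane) : (W ∪ B : Set Plane).Finite :=
  W.finite_toSet.union B.finite_toSet

theorem BoundaryPoint.supported (p : BoundaryPoint W B) : Supported (W ∪ B : Set Plane) p.1 :=
  supported_of_mem_frontier ⟨p.1, p.2.1⟩ (subset_convexHull ℝ _ p.2.1) p.2.2

/-- A chain of hull edges with ends of equal color stays in one color interval. -/
theorem reachable_of_hullChain {S : Plane → Prop}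
    (hS : ∀ x y, HullStep (W ∪ B : Set Plane) S x y → (x ∈ W ↔ y ∈ W)) {p q : BoundaryPoint W B}
    (h : Relation.ReflTransGen (HullStep (W ∪ B : Set Plane) S) p.1 q.1) :
    (sameColorGraph W B).Reachable p q := by
  have key : ∀ y, Relation.ReflTransGen (HullStep (W ∪ B : Set Plane) S) p.1 y →
      ∃ hy, (sameColorGraph W B).Reachable p ⟨y, hy⟩ := by
    intro y hy
    induction hy with
    | refl => exact ⟨p.2, SimpleGraph.Reachable.refl _⟩
    | @tail y z _ hstep ih =>
      obtain ⟨hy, hr⟩ := ih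
      obtain ⟨hyz, -, hz, hedge, -, -⟩ := id hstep
      have hadj : (sameColorGraph W B).Adj ⟨y, hy⟩ ⟨z, hz, hedge (right_mem_segment ℝ _ _)⟩ :=
        ⟨fun h => hyz (congrArg Subtype.val h), hedge, hS y z hstep⟩
      exact ⟨_, hr.trans hadj.reachable⟩
  obtain ⟨_, hr⟩ := key q.1 h
  exact hr

theorem mem_white_iff_of_reachable {p q : BoundaryPoint W B}
    (h : (sameColorGraph W B).Reachable p q) : p.1 ∈ W ↔ q.1 ∈ W := by
  obtain ⟨w⟩ := h
  induction w with
  | nil => rfl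
  | cons hadj _ ih => exact hadj.2.2.trans ih

/-- Let `A` be to the left of `B` and let `C` be comparable to both. If the white ends of `A` and
`B` and the black end of `C` are on the boundary of the convex hull, then the black end of `C` is
not to the right of the line through the two white ends. -/
theorem not_supported_below {F : Set Plane} {A B C : DirSeg} (hA₁ : A.1 ∈ F) (hA₂ : A.2 ∈ F)
    (hB₁ : B.1 ∈ F) (hB₂ : B.2 ∈ F) (hC₁ : C.1 ∈ F) (hC₂ : C.2 ∈ F) (hAB : Sided A B)
    (hCA : C = A ∨ Sided C A ∨ Sided A C) (hCB : C = B ∨ Sided C B ∨ Sided B C)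
    (sA : Supported F A.1) (sB : Supported F B.1) (sC : Supported F C.2)
    (h : 0 < turn B.1 A.1 C.2) : False := by
  have hAB' := hAB
  rw [sided_iff] at hAB'
  obtain ⟨⟨a1, -⟩, a3, -⟩ := hAB'
  rcases hCA with rfl | hCA | hAC
  · rw [turn_rotate] at h
    exact lt_asymm h a1
  · -- `A.1` lies in the triangle spanned by `C.2`, `B.1` and `A.2`.
    rw [sided_iff] at hCA
    obtain ⟨-, -, c⟩ := hCA
    refine sA.false_of_triangle hC₂ hB₁ hA₂ ?_ ?_ ?_
    · unfold turn at *; linarith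
    · unfold turn at *; linarith
    · unfold turn at *; linarith
  · rcases hCB with rfl | hCB | hBC
    · unfold turn at *; linarith
    · -- `C.2` lies in the triangle spanned by `A.1`, `C.1` and `B.1`.
      rw [sided_iff] at hAC hCB
      obtain ⟨-, c, -⟩ := hAC
      obtain ⟨⟨d, -⟩, -⟩ := hCB
      refine sC.false_of_triangle hA₁ hC₁ hB₁ ?_ ?_ ?_
      · unfold turn at *; linarith
      · unfold turn at *; linarith
      · exact h
    · -- `B.1` lies in the triangle spanned by `A.1`, `C.2` and `B.2`.
      rw [sided_iff] at hBC
      obtain ⟨⟨-, c⟩, -⟩ := hBC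
      refine sB.false_of_triangle hA₁ hC₂ hB₂ ?_ ?_ ?_
      · unfold turn at *; linarith
      · unfold turn at *; linarith
      · unfold turn at *; linarith

theorem reachable_of_white (hF : IsBichromatic n W B) (hM : IsBRMatching W B M)
    (hP : PairwiseSided M) {p q : BoundaryPoint W B} (hp : p.1 ∈ W) (hq : q.1 ∈ W) :
    (sameColorGraph W B).Reachable p q := by
  by_cases hpq : p = q
  · rw [hpq]
  obtain ⟨P, ⟨hPM, hP1⟩, -⟩ := hM.white _ hp
  obtain ⟨Q, ⟨hQM, hQ1⟩, -⟩ := hM.white _ hq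
  have hne : P ≠ Q := by rintro rfl; exact hpq (Subtype.ext (hP1.symm.trans hQ1))
  have key : ∀ {p q : BoundaryPoint W B} {P Q : DirSeg}, P ∈ M → Q ∈ M → P.1 = p.1 → Q.1 = q.1 →
      Sided P Q → (sameColorGraph W B).Reachable q p := by
    intro p q P Q hPM hQM hP1 hQ1 hs
    have hne : q.1 ≠ p.1 := fun h => hs.ne (hM.eq_of_fst hPM hQM (hP1.trans (h.symm.trans hQ1.symm)))
    refine reachable_of_hullChain (S := fun x => x ∈ W)
      (fun x y h => iff_of_true h.2.2.2.2.1 h.2.2.2.2.2)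
      (exists_hullChain (finite_union W B) hF.generalPosition _ q.2.1 p.2.1 hne q.supported
        p.supported ?_)
    rintro x hx hsx (rfl | rfl | h)
    · rw [← hQ1]; exact (hM.ends _ hQM).1
    · rw [← hP1]; exact (hM.ends _ hPM).1
    · by_contra hxW
      obtain ⟨C, ⟨hC, rfl⟩, -⟩ := hM.black x (hx.resolve_left hxW)
      have cmp : ∀ X ∈ M, C = X ∨ Sided C X ∨ Sided X C := fun X hX =>
        or_iff_not_imp_left.2 fun hCX => hP C hC X hX hCX
      rw [← hP1, ← hQ1] at h
      exact not_supported_below (hM.mem_fst hPM) (hM.mem_snd hPM) (hM.mem_fst hQM)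
        (hM.mem_snd hQM) (hM.mem_fst hC) (hM.mem_snd hC) hs (cmp P hPM) (cmp Q hQM)
        (hP1 ▸ p.supported) (hQ1 ▸ q.supported) hsx h
  rcases hP P hPM Q hQM hne with h | h
  · exact (key hPM hQM hP1 hQ1 h).symm
  · exact key hQM hPM hQ1 hP1 h

theorem reachable_of_black (hF : IsBichromatic n W B) (hM : IsBRMatching W B M)
    (hP : PairwiseSided M) {p q : BoundaryPoint W B} (hp : p.1 ∈ B) (hq : q.1 ∈ B) :
    (sameColorGraph W B).Reachable p q := by
  by_cases hpq : p = q
  · rw [hpq]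
  obtain ⟨P, ⟨hPM, hP1⟩, -⟩ := hM.black _ hp
  obtain ⟨Q, ⟨hQM, hQ1⟩, -⟩ := hM.black _ hq
  have hne : P ≠ Q := by rintro rfl; exact hpq (Subtype.ext (hP1.symm.trans hQ1))
  have key : ∀ {p q : BoundaryPoint W B} {P Q : DirSeg}, P ∈ M → Q ∈ M → P.2 = p.1 → Q.2 = q.1 →
      Sided P Q → (sameColorGraph W B).Reachable p q := by
    intro p q P Q hPM hQM hP1 hQ1 hs
    have hne : p.1 ≠ q.1 := fun h => hs.ne (hM.eq_of_snd hPM hQM (hP1.trans (h.trans hQ1.symm)))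
    refine reachable_of_hullChain (S := fun x => x ∉ W)
      (fun x y h => iff_of_false h.2.2.2.2.1 h.2.2.2.2.2)
      (exists_hullChain (finite_union W B) hF.generalPosition _ p.2.1 q.2.1 hne p.supported
        q.supported ?_)
    have black : ∀ {X}, X ∈ M → X.2 ∉ W := fun {X} hX h =>
      Finset.disjoint_left.1 hF.disj h (hM.ends X hX).2
    rintro x hx hsx (rfl | rfl | h)
    · rw [← hP1]; exact black hPM
    · rw [← hQ1]; exact black hQM
    · intro hxW
      obtain ⟨C, ⟨hC, rfl⟩, -⟩ := hM.white x hxW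
      have cmp : ∀ X ∈ M, C.swap = X.swap ∨ Sided C.swap X.swap ∨ Sided X.swap C.swap := by
        intro X hX
        by_cases hCX : C = X
        · exact Or.inl (by rw [hCX])
        · exact Or.inr ((hP C hC X hX hCX).symm.imp Sided.swap Sided.swap)
      rw [← hP1, ← hQ1] at h
      have sP : Supported (W ∪ B : Set Plane) P.2 := hP1 ▸ p.supported
      have sQ : Supported (W ∪ B : Set Plane) Q.2 := hQ1 ▸ q.supported
      -- Reversing all segments turns this into the statement about white points.
      exact not_supported_below (A := Q.swap) (B := P.swap) (C := C.swap) (hM.mem_snd hQM)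
        (hM.mem_fst hQM) (hM.mem_snd hPM) (hM.mem_fst hPM) (hM.mem_snd hC) (hM.mem_fst hC)
        hs.swap (cmp Q hQM) (cmp P hPM) sQ sP hsx h
  rcases hP P hPM Q hQM hne with h | h
  · exact key hPM hQM hP1 hQ1 h
  · exact (key hQM hPM hQ1 hP1 h).symm

theorem turn_nonpos_of_source (hM : IsBRMatching W B M) {A : DirSeg}
    (hfirst : ∀ X ∈ M, X ≠ A → Sided A X) :
    ∀ y ∈ (W ∪ B : Set Plane), turn A.1 A.2 y ≤ 0 := by
  rintro y (hy | hy)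
  · obtain ⟨X, ⟨hX, rfl⟩, -⟩ := hM.white y hy
    by_cases hXA : X = A
    · rw [hXA]; simp
    · exact (hfirst X hX hXA).1.1.le
  · obtain ⟨X, ⟨hX, rfl⟩, -⟩ := hM.black y hy
    by_cases hXA : X = A
    · rw [hXA]; simp
    · exact (hfirst X hX hXA).1.2.le

/-- The convex hull of the points of a linearly ordered matching has two color intervals. -/
theorem card_colorInterval (hn : 1 ≤ n) (hF : IsBichromatic n W B) (hM : IsBRMatching W B M)
    (hO : IsStrictTotalOrder {A : DirSeg // A ∈ M} (fun A A' => Sided A.1 A'.1)) :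
    Nat.card (ColorInterval W B) = 2 := by
  classical
  have hP := (isStrictTotalOrder_iff.1 hO).1
  let : LinearOrder {A : DirSeg // A ∈ M} :=
    linearOrderOfSTO (fun A A' : {A : DirSeg // A ∈ M} => Sided A.1 A'.1)
  obtain ⟨p, hp⟩ : W.Nonempty := by rw [← Finset.card_pos, hF.card_white]; exact hn
  obtain ⟨P, ⟨hPM, -⟩, -⟩ := hM.white p hp
  have : Nonempty {A : DirSeg // A ∈ M} := ⟨⟨P, hPM⟩⟩
  obtain ⟨A, hA⟩ := Finite.exists_min (id : {A : DirSeg // A ∈ M} → {A : DirSeg // A ∈ M})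
  have hfirst : ∀ X ∈ M, X ≠ A.1 → Sided A.1 X := fun X hX hne =>
    show A < ⟨X, hX⟩ from lt_of_le_of_ne (hA ⟨X, hX⟩) fun h => hne (congrArg Subtype.val h.symm)
  have hedge : HullEdge (W ∪ B : Set Plane) A.1.1 A.1.2 :=
    hullEdge_of_turn_nonpos (hM.mem_fst A.2) (hM.mem_snd A.2)
      (IsBRMatching.fst_ne_snd hF hM A.2 A.2) (turn_nonpos_of_source hM hfirst)
  have hAW := (hM.ends _ A.2).1
  have hAB := (hM.ends _ A.2).2
  have hAB' : A.1.2 ∉ W := fun h => Finset.disjoint_left.1 hF.disj h hAB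
  let w : BoundaryPoint W B := ⟨A.1.1, hM.mem_fst A.2, hedge (left_mem_segment ℝ _ _)⟩
  let b : BoundaryPoint W B := ⟨A.1.2, hM.mem_snd A.2, hedge (right_mem_segment ℝ _ _)⟩
  rw [Nat.card_eq_two_iff]
  refine ⟨(sameColorGraph W B).connectedComponentMk w, (sameColorGraph W B).connectedComponentMk b,
    fun h => ?_, ?_⟩
  · exact hAB' ((mem_white_iff_of_reachable (SimpleGraph.ConnectedComponent.eq.1 h)).1 hAW)
  · ext c
    refine ⟨fun _ => Set.mem_univ _, fun _ => ?_⟩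
    induction c using SimpleGraph.ConnectedComponent.ind with
    | h x =>
      rcases x.2.1 with hx | hx
      · exact Or.inl (SimpleGraph.ConnectedComponent.eq.2 (reachable_of_white hF hM hP hx hAW))
      · exact Or.inr (SimpleGraph.ConnectedComponent.eq.2 (reachable_of_black hF hM hP hx hAB))

/-- If there are two color intervals, then some hull edge has ends of different colors. -/
theorem exists_mixed_hullEdge (hF : IsBichromatic n W B)
    (hcard : Nat.card (ColorInterval W B) = 2) :
    ∃ w ∈ W, ∃ b ∈ B, HullEdge (W ∪ B : Set Plane) w b := by
  by_contra hcon
  push Not at hcon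
  obtain ⟨c, d, hcd, -⟩ := Nat.card_eq_two_iff.1 hcard
  induction c using SimpleGraph.ConnectedComponent.ind with
  | h x =>
    induction d using SimpleGraph.ConnectedComponent.ind with
    | h y =>
      refine hcd (SimpleGraph.ConnectedComponent.eq.2 ?_)
      have hxy : x.1 ≠ y.1 := by
        intro h
        exact hcd (by rw [Subtype.ext h])
      refine reachable_of_hullChain (S := fun _ => True) ?_
        (exists_hullChain (finite_union W B) hF.generalPosition _ x.2.1 y.2.1 hxy x.supported
          y.supported fun _ _ _ _ => trivial)
      rintro s t ⟨-, hs, ht, hedge, -⟩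
      constructor
      · intro hsW
        by_contra htW
        exact hcon s hsW t (ht.resolve_left htW) hedge
      · intro htW
        by_contra hsW
        exact hcon t htW s (hs.resolve_left hsW) hedge.symm

/-- If the segments are pairwise comparable, a hull edge with ends of different colors belongs to
the matching: otherwise it would be crossed by the segment that joins the partners of its ends. -/
theorem mem_of_mixed_hullEdge (hF : IsBichromatic n W B) (hM : IsBRMatching W B M)
    (hP : PairwiseSided M) {w b : Plane} (hw : w ∈ W) (hb : b ∈ B)
    (hedge : HullEdge (W ∪ B : Set Plane) w b) : ((w, b) : DirSeg) ∈ M := by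
  obtain ⟨A, ⟨hA, rfl⟩, -⟩ := hM.white w hw
  obtain ⟨X, ⟨hX, rfl⟩, -⟩ := hM.black b hb
  by_cases hAX : A = X
  · rw [hAX]; exact hX
  exfalso
  have hmeet : ∃ x, x ∈ segment ℝ A.1 X.2 ∧ x ∈ segment ℝ X.1 A.2 := by
    rcases hP A hA X hX hAX with h | h
    · exact h.diagonals_meet
    · obtain ⟨x, h1, h2⟩ := h.diagonals_meet
      exact ⟨x, h2, h1⟩
  obtain ⟨x, hx, hx'⟩ := hmeet
  have h0 : turn A.1 X.2 x = 0 := by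
    obtain ⟨s, t, -, -, hst, rfl⟩ := hx
    rw [turn_combo _ _ _ _ hst]; simp
  have n1 : X.1 ≠ A.1 := fun h => hAX (hM.eq_of_fst hA hX h.symm)
  have n2 : X.1 ≠ X.2 := IsBRMatching.fst_ne_snd hF hM hX hX
  have n3 : A.2 ≠ A.1 := (IsBRMatching.fst_ne_snd hF hM hA hA).symm
  have n4 : A.2 ≠ X.2 := fun h => hAX (hM.eq_of_snd hA hX h)
  rcases hedge.one_side hF.generalPosition (hM.mem_fst hA) (hM.mem_snd hX)
    (IsBRMatching.fst_ne_snd hF hM hA hX) with h | h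
  · exact (turn_neg_of_mem_segment hx' (h _ (hM.mem_fst hX) n1 n2) (h _ (hM.mem_snd hA) n3 n4)).ne h0
  · exact (turn_pos_of_mem_segment hx' (h _ (hM.mem_fst hX) n1 n2)
      (h _ (hM.mem_snd hA) n3 n4)).ne' h0

theorem isChromaticCut_of_mul_neg {A A' : DirSeg} (hA : A ∈ M) (hA' : A' ∈ M) {p q : Plane}
    (h1 : A.CrossedBy p q) (h2 : A'.CrossedBy p q) (h : turn p q A.2 * turn p q A'.2 < 0) :
    IsChromaticCut M p q := by
  refine ⟨?_, ?_⟩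
  · rintro rfl
    simp at h
  · rcases mul_neg_iff.1 h with ⟨a, b⟩ | ⟨a, b⟩
    · exact ⟨A, hA, A', hA', h1, h2, a, b⟩
    · exact ⟨A', hA', A, hA, h2, h1, b, a⟩

theorem pairwiseSided_of_no_cut (hF : IsBichromatic n W B) (hM : IsBRMatching W B M)
    (h : ¬ ∃ p q : Plane, IsChromaticCut M p q) : PairwiseSided M := by
  intro A hA A' hA' hne
  by_contra hcon
  push Not at hcon
  obtain ⟨p, q, h1, h2, h3⟩ := (IsBRMatching.generic hF hM hA hA' hne).exists_cut hcon.1 hcon.2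
  exact h ⟨p, q, isChromaticCut_of_mul_neg hA hA' h1 h2 h3⟩

theorem no_cut_of_pairwiseSided (hP : PairwiseSided M) :
    ¬ ∃ p q : Plane, IsChromaticCut M p q := by
  rintro ⟨p, q, -, A, hA, A', hA', h1, h2, h3, h4⟩
  have hlt : turn p q A.2 * turn p q A'.2 < 0 := mul_neg_of_pos_of_neg h3 h4
  have hne : A ≠ A' := by rintro rfl; exact lt_asymm h3 h4
  rcases hP A hA A' hA' hne with h | h
  · exact h.not_cut p q h1 h2 hlt
  · exact h.not_cut p q h2 h1 (by rwa [mul_comm])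

/-- A linear matching has no cycle: a hull edge with ends of different colors is a segment of the
matching that has all other segments on one side. -/
theorem noSidedCycle_of_isLinearMatching (hF : IsBichromatic n W B) (hM : IsBRMatching W B M)
    (hP : PairwiseSided M) (hcard : Nat.card (ColorInterval W B) = 2) : NoSidedCycle M := by
  obtain ⟨w, hw, b, hb, hedge⟩ := exists_mixed_hullEdge hF hcard
  have hA := mem_of_mixed_hullEdge hF hM hP hw hb hedge
  have hwb : w ≠ b := IsBRMatching.fst_ne_snd hF hM hA hA
  have ends : ∀ X ∈ M, X ≠ ((w, b) : DirSeg) → X.1 ≠ w ∧ X.1 ≠ b :=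
    fun X hX hne => ⟨fun h => hne (hM.eq_of_fst hX hA h),
      IsBRMatching.fst_ne_snd hF hM hX hA⟩
  intro X hX Y hY Z hZ h1 h2 h3
  rcases hedge.one_side hF.generalPosition (Or.inl hw) (Or.inr hb) hwb with h | h
  · have first : ∀ X ∈ M, X ≠ ((w, b) : DirSeg) → Sided (w, b) X := fun X hX hne =>
      (hP _ hA X hX hne.symm).resolve_right fun hs =>
        lt_asymm hs.2.1 (h X.1 (hM.mem_fst hX) (ends X hX hne).1 (ends X hX hne).2)
    have after : ∀ S ∈ M, ∀ T ∈ M, Sided S T → Sided (w, b) T := fun S hS T hT hst =>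
      first T hT (by
        rintro rfl
        exact hst.asymm (first S hS hst.ne))
    exact not_source_of_cycle (after Z hZ X hX h3) (after X hX Y hY h1) (after Y hY Z hZ h2) h1 h2 h3
  · have last : ∀ X ∈ M, X ≠ ((w, b) : DirSeg) → Sided X (w, b) := fun X hX hne =>
      (hP X hX _ hA hne).resolve_right fun hs =>
        lt_asymm hs.1.1 (h X.1 (hM.mem_fst hX) (ends X hX hne).1 (ends X hX hne).2)
    have before : ∀ S ∈ M, ∀ T ∈ M, Sided S T → Sided S (w, b) := fun S hS T hT hst =>
      last S hS (by
        rintro rfl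
        exact hst.asymm (last T hT hst.ne.symm))
    exact not_sink_of_cycle (before X hX Y hY h1) (before Y hY Z hZ h2) (before Z hZ X hX h3) h1 h2 h3

end ColorIntervals

theorem theorem2 (n : ℕ) (hn : 1 ≤ n) (W B : Finset Plane) (hF : IsBichromatic n W B)
    (M : Finset DirSeg) (hM : IsBRMatching W B M) :
    List.TFAE [
      ∀ M' : Finset DirSeg, IsBRMatching W B M' → M' = M,
      IsLinearMatching W B M,
      IsStrictTotalOrder {A : DirSeg // A ∈ M} (fun A A' => DirSeg.Sided A.1 A'.1),
      AvoidsPatterns M,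
      IsQuasiParallel M] := by
  tfae_have 1 → 3 := fun h =>
    have hP := pairwiseSided_of_unique hF hM h
    isStrictTotalOrder_iff.2 ⟨hP, noSidedCycle_of_unique hF hM h hP⟩
  tfae_have 3 → 1 := fun h _ hM' => eq_of_isStrictTotalOrder hF hM h hM'
  tfae_have 3 → 2 := fun h =>
    ⟨no_cut_of_pairwiseSided (isStrictTotalOrder_iff.1 h).1, card_colorInterval hn hF hM h⟩
  tfae_have 2 → 3 := fun h =>
    have hP := pairwiseSided_of_no_cut hF hM h.1
    isStrictTotalOrder_iff.2 ⟨hP, noSidedCycle_of_isLinearMatching hF hM hP h.2⟩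
  tfae_have 4 ↔ 3 := (avoidsPatterns_iff hF hM).trans isStrictTotalOrder_iff.symm
  tfae_have 3 → 5 := isQuasiParallel_of_isStrictTotalOrder hn hF hM
  tfae_have 5 → 4 := avoidsPatterns_of_isQuasiParallel hF hM
  tfae_finish
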